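/- **Theorem.** Let $0<y<1$ and let $u:[0,\infty)\to(0,\infty)$ satisfy * **A1.** $\psi(x)=x\,u(x)$ is strictly increasing on $[0,\infty)$ and $\lim_{x\to\infty}\psi(x)>y$ (the limit may be $+\infty$); * **A2.** $u$ is twice differentiable on $[0,\infty)$ and $x\,u'(x)<u(x)$ for all $x\ge 0$. For $\boldsymbol x_1,\dots,\boldsymbol x_n\in\mathbb R^p$, Maronna's M-estimator $\bar\Sigma$ is the positive definite $p\times p$ matrix solving $$\bar\Sigma=\sum_{i=1}^n u\big(\boldsymbol x_i^T\bar\Sigma^{-1}\boldsymbol x_i\big)\,\boldsymbol x_i\boldsymbol x_i^T ,$$ and $\boldsymbol S_n=\frac1n\sum_{i=1}^n\boldsymbol x_i\boldsymbol x_i^T$. Let $\psi^{-1}(y)$ be the unique $w\ge 0$ with $w\,u(w)=y$, and let $\|\cdot\|$ be the operator norm. In both parts $\boldsymbol x_1,\dots,\boldsymbol x_n$ are i.i.d. $N(\mathbf 0,\mathbf I)$ in $\mathbb R^p$. 1. (Almost sure convergence.) Let $p=p_n$ with $p_n/n\to y$, and for each $n$ let a sample of size $n$ in $\mathbb R^{p_n}$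 be given, all samples being defined on one probability space (with any dependence between different $n$). Then almost surely, for all sufficiently large $n$ the estimator $\bar\Sigma$ exists and is unique, and $$\Big\|\frac{\psi^{-1}(y)}{n\,y}\,\bar\Sigma-\boldsymbol S_n\Big\|\longrightarrow 0\qquad(n\to\infty).$$ 2. (Rate.) There exist $C,c,c'>0$, depending only on $u$ and $y$, such that for every $0<\varepsilon<c'$ there is $\delta>0$ such that for all $n\ge1$ and all $p$ with $|p/n-y|\le\delta$, $$\Pr\Big(\bar\Sigma\text{ exists, is unique, and }\Big\|\frac{\psi^{-1}(y)}{n\,y}\,\bar\Sigma-\boldsymbol S_n\Big\|\le\varepsilon\Big)\ \ge\ 1-C\,n\,e^{-c\varepsilon^2 n}.$$ In particular this holds for all $n$ if $p/n=y$, and for all sufficiently large $n$ (depending on $\varepsilon$) if $p=p_n$ with $p_n/n\to y$. Note that $\frac{\psi^{-1}(y)}{n\,y}=\frac{1}{n\,u(\psi^{-1}(y))}$. -/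

import Mathlib

open MeasureTheory ProbabilityTheory Filter Set
open scoped Topology Matrix Matrix.Norms.L2Operator

noncomputable section

/-- The function `ψ(x) = x u(x)`. Only its values on `[0, ∞)` matter. -/
def maronnaPsi (u : ℝ → ℝ) (x : ℝ) : ℝ := x * u x

/-- The inverse function `ψ⁻¹` of `ψ : [0, ∞) → [0, ∞)`. -/
def maronnaPsiInv (u : ℝ → ℝ) (t : ℝ) : ℝ := Function.invFunOn (maronnaPsi u) (Ici 0) t

/-- Assumption A1: `u : [0, ∞) → (0, ∞)`, `ψ` is (strictly) increasing, and the limit of `ψ` at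
infinity, which may be `+∞`, is greater than `y`. -/
structure AssumptionA1 (u : ℝ → ℝ) (y : ℝ) : Prop where
  pos : ∀ x, 0 ≤ x → 0 < u x
  psi_strictMonoOn : StrictMonoOn (maronnaPsi u) (Ici 0)
  lim_psi : ∃ L : EReal, Tendsto (fun x : ℝ => (maronnaPsi u x : EReal)) atTop (𝓝 L) ∧
    (y : EReal) < L

/-- Assumption A2: `u` is twice differentiable on `[0, ∞)` (one-sided at `0`), and
`x u'(x) < u(x)`. -/
structure AssumptionA2 (u : ℝ → ℝ) : Prop where
  differentiableOn : DifferentiableOn ℝ u (Ici 0)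
  differentiableOn_deriv : DifferentiableOn ℝ (derivWithin u (Ici 0)) (Ici 0)
  mul_deriv_lt : ∀ x, 0 ≤ x → x * derivWithin u (Ici 0) x < u x

variable {n p : ℕ}

/-- `S` is a solution of Maronna's equation `S = ∑ i, u (xᵢᵀ S⁻¹ xᵢ) xᵢ xᵢᵀ` among the
positive definite matrices. -/
def IsMaronnaSolution (u : ℝ → ℝ) (x : Fin n → EuclideanSpace ℝ (Fin p))
    (S : Matrix (Fin p) (Fin p) ℝ) : Prop :=
  S.PosDef ∧
    S = ∑ i, u ((x i).ofLp ⬝ᵥ (S⁻¹ *ᵥ (x i).ofLp)) • Matrix.vecMulVec (x i).ofLp (x i).ofLp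

open Classical in
/-- Maronna's M-estimator: the solution of Maronna's equation (and `0` if there is none). -/
def maronnaEstimator (u : ℝ → ℝ) (x : Fin n → EuclideanSpace ℝ (Fin p)) :
    Matrix (Fin p) (Fin p) ℝ :=
  if h : ∃ S, IsMaronnaSolution u x S then h.choose else 0

/-- The sample covariance matrix `n⁻¹ ∑ i, xᵢ xᵢᵀ`. -/
def sampleCov (x : Fin n → EuclideanSpace ℝ (Fin p)) : Matrix (Fin p) (Fin p) ℝ :=
  (1 / (n : ℝ)) • ∑ i, Matrix.vecMulVec (x i).ofLp (x i).ofLp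

/-- The operator norm distance between the scaled Maronna estimator
`(ψ⁻¹(y) / (n y)) Σ̄ = Σ̄ / (n u(ψ⁻¹(y)))` and the sample covariance matrix. -/
def maronnaError (u : ℝ → ℝ) (y : ℝ) (x : Fin n → EuclideanSpace ℝ (Fin p)) : ℝ :=
  ‖(maronnaPsiInv u y / ((n : ℝ) * y)) • maronnaEstimator u x - sampleCov x‖

/-- `X 0, …, X (n - 1)` are independent random vectors with law `N(0, I)` on `ℝᵖ`. -/
structure IsGaussianSample {Ω : Type*} [MeasurableSpace Ω] (μ : Measure Ω)
    (X : Fin n → Ω → EuclideanSpace ℝ (Fin p)) : Prop where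
  law : ∀ i, HasLaw (X i) (stdGaussian (EuclideanSpace ℝ (Fin p))) μ
  indep : iIndepFun X μ

end

/-!
Let `X` be the data matrix with rows `xᵢᵀ` and `H = X (XᵀX)⁻¹ Xᵀ` its hat matrix. In the
coordinates `tᵢ = log (xᵢᵀ Σ⁻¹ xᵢ)`, Maronna's equation becomes a fixed point equation `t = F t`.
Assumptions A1 and A2 make `t ↦ log u (eᵗ)` strictly decrease distances, hence so does `F` for the
sup distance. This gives uniqueness, and existence as soon as `F` maps a compact box to itself.

If all leverages `Hᵢᵢ` were equal to `y = p / n`, the constant vector with `ψ (eᵗ) = y` would be the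
solution, and `Σ̄` a multiple of `XᵀX`. If the leverages are only `ε`-close to `y`, the weights
`u (eᵗⁱ)` are still constant up to `O(ε)`. Where `ψ' > 0`, this holds because `F` is a contraction
near the constant vector. Where `ψ' = 0`, one has `u' < 0`, so that the extreme weights sit at the
extreme lengths; if they differed by more than `O(ε)`, the lengths would move the wrong way,
provided that every row of `H` has a fixed share of its squared mass on every half of the indices.
Hence the error is `O(ε) ‖X‖² / n`.

For Gaussian data, the law of `X` is invariant under `X ↦ O X` for orthogonal `O`, which conjugates
`H` by `O`. So `Hᵢᵢ` is distributed like `gᵀ H g / ‖g‖²` for a Gaussian `g` independent of `H`,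
which concentrates around `p / n`, and the off-diagonal part of a row of `H` has uniform direction,
which makes its mass spread out. Finally, `‖X v‖²` is convex in `v`, so `‖X‖²` is controlled by its
average over a ball, and the Borel–Cantelli lemma gives almost sure convergence.
-/

section HatMatrix

variable {ι κ : Type*} [Fintype ι] [Fintype κ] [DecidableEq κ] {X : Matrix ι κ ℝ}

/-- The hat matrix of linear regression: if `X` has full column rank, this is the orthogonal
projection onto its column space. Its diagonal entries are called leverages. -/
noncomputable def hatMatrix (X : Matrix ι κ ℝ) : Matrix ι ι ℝ :=
  X * (Xᵀ * X)⁻¹ * Xᵀ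

theorem row_ne_zero_of_hatMatrix_pos {i : ι} (hi : 0 < hatMatrix X i i) : X i ≠ 0 := by
  intro hrow
  rw [hatMatrix, Matrix.mul_assoc, Matrix.mul_apply_eq_vecMul, hrow, Matrix.zero_vecMul] at hi
  exact hi.false

theorem isUnit_det_transpose_mul_self (hX : Function.Injective X.mulVec) :
    IsUnit (Xᵀ * X).det := by
  rw [← Matrix.conjTranspose_eq_transpose_of_trivial, ← Matrix.isUnit_iff_isUnit_det]
  exact (Matrix.PosDef.conjTranspose_mul_self X hX).isUnit

theorem isStarProjection_hatMatrix (hX : Function.Injective X.mulVec) :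
    IsStarProjection (hatMatrix X) where
  isIdempotentElem :=
    calc hatMatrix X * hatMatrix X = X * (Xᵀ * X)⁻¹ * ((Xᵀ * X) * (Xᵀ * X)⁻¹) * Xᵀ := by
          simp only [hatMatrix, Matrix.mul_assoc]
      _ = hatMatrix X := by
          rw [Matrix.mul_nonsing_inv _ (isUnit_det_transpose_mul_self hX), Matrix.mul_one,
            hatMatrix]
  isSelfAdjoint := by
    rw [IsSelfAdjoint, Matrix.star_eq_conjTranspose, Matrix.conjTranspose_eq_transpose_of_trivial]
    simp only [hatMatrix, Matrix.transpose_mul, Matrix.transpose_nonsing_inv,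
      Matrix.transpose_transpose, Matrix.mul_assoc]

theorem sum_hatMatrix_sq (hX : Function.Injective X.mulVec) (i : ι) :
    ∑ j, hatMatrix X i j ^ 2 = hatMatrix X i i := by
  obtain ⟨hidem, hself⟩ := isStarProjection_hatMatrix hX
  have hsymm : (hatMatrix X).IsSymm :=
    (Matrix.conjTranspose_eq_transpose_of_trivial _).symm.trans hself
  calc ∑ j, hatMatrix X i j ^ 2 = ∑ j, hatMatrix X i j * hatMatrix X j i :=
        Finset.sum_congr rfl fun j _ => by rw [sq, hsymm.apply j i]
    _ = hatMatrix X i i := by rw [← Matrix.mul_apply, hidem.eq]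

theorem trace_hatMatrix (hX : Function.Injective X.mulVec) :
    (hatMatrix X).trace = Fintype.card κ := by
  rw [hatMatrix, Matrix.trace_mul_comm, ← Matrix.mul_assoc,
    Matrix.mul_nonsing_inv _ (isUnit_det_transpose_mul_self hX), Matrix.trace_one]

end HatMatrix

section WeightedScatter

variable {ι κ : Type*} [Fintype ι] [DecidableEq ι] {X : Matrix ι κ ℝ} {w w' : ι → ℝ}

/-- The weighted scatter matrix `∑ i, w i • xᵢ xᵢᵀ` of the rows `xᵢ` of `X`. -/
def weightedScatter (X : Matrix ι κ ℝ) (w : ι → ℝ) : Matrix κ κ ℝ :=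
  Xᵀ * Matrix.diagonal w * X

theorem weightedScatter_eq_sum (X : Matrix ι κ ℝ) (w : ι → ℝ) :
    weightedScatter X w = ∑ i, w i • Matrix.vecMulVec (X i) (X i) := by
  ext k l
  simp only [weightedScatter, Matrix.mul_apply (M := Xᵀ * Matrix.diagonal w), Matrix.mul_diagonal,
    Matrix.transpose_apply, Matrix.sum_apply, Matrix.smul_apply, Matrix.vecMulVec_apply,
    smul_eq_mul]
  exact Finset.sum_congr rfl fun i _ => by ring

theorem weightedScatter_sub (X : Matrix ι κ ℝ) (w w' : ι → ℝ) :
    weightedScatter X w - weightedScatter X w' = weightedScatter X (w - w') := by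
  simp only [weightedScatter, ← Matrix.mul_sub, ← Matrix.sub_mul, Matrix.diagonal_sub, Pi.sub_def]

theorem weightedScatter_smul (X : Matrix ι κ ℝ) (c : ℝ) (w : ι → ℝ) :
    weightedScatter X (c • w) = c • weightedScatter X w := by
  simp only [weightedScatter, Matrix.diagonal_smul, Matrix.mul_smul, Matrix.smul_mul]

theorem posDef_weightedScatter [Fintype κ] (hX : Function.Injective X.mulVec) (hw : ∀ i, 0 < w i) :
    (weightedScatter X w).PosDef := by
  simpa only [weightedScatter, Matrix.conjTranspose_eq_transpose_of_trivial]
    using (Matrix.PosDef.diagonal hw).conjTranspose_mul_mul_same hX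

variable [Fintype κ] [DecidableEq κ]

/-- The matrix of all products `xᵢᵀ S⁻¹ xⱼ`, where `S` is the weighted scatter matrix of the
rows `xᵢ` of `X`. -/
noncomputable def weightedHat (X : Matrix ι κ ℝ) (w : ι → ℝ) : Matrix ι ι ℝ :=
  X * (weightedScatter X w)⁻¹ * Xᵀ

/-- The squared Mahalanobis length `xᵢᵀ S⁻¹ xᵢ` of the `i`-th row of `X`, where `S` is the
weighted scatter matrix. -/
noncomputable def mahalanobis (X : Matrix ι κ ℝ) (w : ι → ℝ) (i : ι) : ℝ :=
  weightedHat X w i i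

theorem norm_weightedScatter_le (X : Matrix ι κ ℝ) (w : ι → ℝ) :
    ‖weightedScatter X w‖ ≤ ‖w‖ * ‖X‖ ^ 2 :=
  calc ‖weightedScatter X w‖ ≤ ‖Xᵀ‖ * ‖Matrix.diagonal w‖ * ‖X‖ :=
        (Matrix.l2_opNorm_mul _ _).trans
          (mul_le_mul_of_nonneg_right (Matrix.l2_opNorm_mul _ _) (norm_nonneg _))
    _ = ‖w‖ * ‖X‖ ^ 2 := by
        rw [Matrix.l2_opNorm_diagonal, ← Matrix.conjTranspose_eq_transpose_of_trivial,
          Matrix.l2_opNorm_conjTranspose]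
        ring

theorem isUnit_det_weightedScatter (hX : Function.Injective X.mulVec) (hw : ∀ i, 0 < w i) :
    IsUnit (weightedScatter X w).det :=
  (Matrix.isUnit_iff_isUnit_det _).1 (posDef_weightedScatter hX hw).isUnit

theorem weightedHat_one (X : Matrix ι κ ℝ) : weightedHat X 1 = hatMatrix X := by
  simp only [weightedHat, weightedScatter, hatMatrix, Matrix.diagonal_one', Matrix.mul_one]

theorem mahalanobis_const (hX : Function.Injective X.mulVec) {c : ℝ} (hc : c ≠ 0) (i : ι) :
    mahalanobis X (fun _ => c) i = hatMatrix X i i / c := by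
  have hscatter : weightedScatter X (fun _ => c) = Units.mk0 c hc • weightedScatter X 1 :=
    (congrArg _ (funext fun _ => (mul_one c).symm)).trans (weightedScatter_smul X c 1)
  rw [mahalanobis, ← weightedHat_one, weightedHat, weightedHat, hscatter,
    Matrix.inv_smul' _ _ (isUnit_det_weightedScatter (w := 1) hX fun _ => one_pos), Matrix.mul_smul,
    Matrix.smul_mul, Matrix.smul_apply, Units.smul_def, Units.val_inv_eq_inv_val, Units.val_mk0,
    smul_eq_mul, inv_mul_eq_div]

theorem mahalanobis_eq_dotProduct (X : Matrix ι κ ℝ) (w : ι → ℝ) (i : ι) :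
    mahalanobis X w i = X i ⬝ᵥ (weightedScatter X w)⁻¹ *ᵥ X i := by
  rw [mahalanobis, weightedHat, Matrix.mul_assoc]
  rfl

theorem weightedHat_transpose (X : Matrix ι κ ℝ) (w : ι → ℝ) :
    (weightedHat X w)ᵀ = weightedHat X w := by
  simp only [weightedHat, weightedScatter, Matrix.transpose_mul, Matrix.transpose_nonsing_inv,
    Matrix.diagonal_transpose, Matrix.transpose_transpose, Matrix.mul_assoc]

theorem weightedHat_comm (X : Matrix ι κ ℝ) (w : ι → ℝ) (i j : ι) :
    weightedHat X w i j = weightedHat X w j i :=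
  congr_fun₂ (weightedHat_transpose X w) j i

theorem weightedHat_mul_diagonal_mul_weightedHat (h : IsUnit (weightedScatter X w).det)
    (w' : ι → ℝ) :
    weightedHat X w' * Matrix.diagonal w * weightedHat X w = weightedHat X w' :=
  calc _ = X * (weightedScatter X w')⁻¹ *
          (weightedScatter X w * (weightedScatter X w)⁻¹) * Xᵀ := by
        simp only [weightedHat, weightedScatter, Matrix.mul_assoc]
    _ = _ := by rw [Matrix.mul_nonsing_inv _ h, Matrix.mul_one, weightedHat]

theorem sum_mul_weightedHat_mul (h : IsUnit (weightedScatter X w).det) (w' : ι → ℝ) (i j : ι) :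
    ∑ k, w k * (weightedHat X w i k * weightedHat X w' j k) = weightedHat X w' i j := by
  rw [weightedHat_comm X w' i j,
    ← congr_fun₂ (weightedHat_mul_diagonal_mul_weightedHat h w') j i, Matrix.mul_apply]
  refine Finset.sum_congr rfl fun k _ => ?_
  rw [Matrix.mul_diagonal, weightedHat_comm X w k i]
  ring

theorem mahalanobis_eq_sum (h : IsUnit (weightedScatter X w).det) (i : ι) :
    mahalanobis X w i = ∑ j, w j * weightedHat X w i j ^ 2 := by
  simp only [sq, sum_mul_weightedHat_mul h, mahalanobis]

theorem sum_mul_mahalanobis (h : IsUnit (weightedScatter X w).det) :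
    ∑ i, w i * mahalanobis X w i = Fintype.card κ :=
  calc ∑ i, w i * mahalanobis X w i
      = (Matrix.diagonal w * (X * (weightedScatter X w)⁻¹ * Xᵀ)).trace := by
        simp only [Matrix.trace, Matrix.diag, Matrix.diagonal_mul, mahalanobis, weightedHat]
    _ = (weightedScatter X w * (weightedScatter X w)⁻¹).trace := by
        rw [← Matrix.mul_assoc, Matrix.trace_mul_comm]
        simp only [weightedScatter, Matrix.mul_assoc]
    _ = Fintype.card κ := by rw [Matrix.mul_nonsing_inv _ h, Matrix.trace_one]

theorem le_mahalanobis (hX : Function.Injective X.mulVec) (hw : ∀ i, 0 < w i)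
    (w' : ι → ℝ) (t : ℝ) (i : ι) :
    2 * t * mahalanobis X w' i - t ^ 2 * ∑ j, w j * weightedHat X w' i j ^ 2 ≤
      mahalanobis X w i := by
  have h := isUnit_det_weightedScatter hX hw
  have square_nonneg :
      0 ≤ ∑ j, w j * (weightedHat X w i j - t * weightedHat X w' i j) ^ 2 :=
    Finset.sum_nonneg fun j _ => mul_nonneg (hw j).le (sq_nonneg _)
  have square_eq : ∑ j, w j * (weightedHat X w i j - t * weightedHat X w' i j) ^ 2 =
      ∑ j, w j * weightedHat X w i j ^ 2 -
        2 * t * ∑ j, w j * (weightedHat X w i j * weightedHat X w' i j) +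
        t ^ 2 * ∑ j, w j * weightedHat X w' i j ^ 2 := by
    simp only [Finset.mul_sum, ← Finset.sum_sub_distrib, ← Finset.sum_add_distrib]
    exact Finset.sum_congr rfl fun j _ => by ring
  rw [square_eq, ← mahalanobis_eq_sum h, sum_mul_weightedHat_mul h] at square_nonneg
  rw [mahalanobis]
  linarith

theorem mahalanobis_le_mul (hX : Function.Injective X.mulVec) (hw : ∀ i, 0 < w i)
    (hw' : ∀ i, 0 < w' i) {c : ℝ} (hc : 0 < c) (h : ∀ i, w i ≤ c * w' i) (i : ι) :
    mahalanobis X w' i ≤ c * mahalanobis X w i := by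
  have quadratic_le : ∑ j, w j * weightedHat X w' i j ^ 2 ≤ c * mahalanobis X w' i := by
    rw [mahalanobis_eq_sum (isUnit_det_weightedScatter hX hw'), Finset.mul_sum]
    refine Finset.sum_le_sum fun j _ => ?_
    rw [← mul_assoc]
    exact mul_le_mul_of_nonneg_right (h j) (sq_nonneg _)
  calc mahalanobis X w' i
      = c * (2 * c⁻¹ * mahalanobis X w' i - c⁻¹ ^ 2 * (c * mahalanobis X w' i)) := by
        field_simp; ring
    _ ≤ c * (2 * c⁻¹ * mahalanobis X w' i -
          c⁻¹ ^ 2 * ∑ j, w j * weightedHat X w' i j ^ 2) := by gcongr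
    _ ≤ c * mahalanobis X w i := by
        gcongr
        exact le_mahalanobis hX hw w' c⁻¹ i

theorem mahalanobis_pos (hX : Function.Injective X.mulVec) (hw : ∀ i, 0 < w i) {i : ι}
    (hi : 0 < hatMatrix X i i) : 0 < mahalanobis X w i := by
  simpa only [mahalanobis_eq_dotProduct, star_trivial]
    using (posDef_weightedScatter hX hw).inv.dotProduct_mulVec_pos (row_ne_zero_of_hatMatrix_pos hi)

theorem mahalanobis_le_sum (hX : Function.Injective X.mulVec) (hw : ∀ i, 0 < w i) (i : ι) :
    mahalanobis X w i ≤ ∑ j, hatMatrix X i j ^ 2 / w j := by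
  have eq_mixed : mahalanobis X w i = ∑ j, hatMatrix X i j * weightedHat X w i j := by
    have h1 := isUnit_det_weightedScatter (w := 1) hX fun _ => one_pos
    rw [mahalanobis, ← sum_mul_weightedHat_mul h1 w i i, weightedHat_one]
    simp only [Pi.one_apply, one_mul]
  have eq_square := mahalanobis_eq_sum (isUnit_det_weightedScatter hX hw) i
  calc mahalanobis X w i
      = ∑ j, (2 * (hatMatrix X i j * weightedHat X w i j) - w j * weightedHat X w i j ^ 2) := by
        rw [Finset.sum_sub_distrib, ← Finset.mul_sum, ← eq_mixed, ← eq_square]; ring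
    _ ≤ ∑ j, hatMatrix X i j ^ 2 / w j := by
        refine Finset.sum_le_sum fun j _ => ?_
        rw [le_div_iff₀ (hw j)]
        nlinarith [sq_nonneg (hatMatrix X i j - w j * weightedHat X w i j)]

end WeightedScatter

section LogarithmicCoordinates

theorem exists_isFixedPt_of_dist_lt {α : Type*} [MetricSpace α] {K : Set α} (hK : IsCompact K)
    (hne : K.Nonempty) {f : α → α} (hmaps : MapsTo f K K)
    (hf : ∀ x y, x ≠ y → dist (f x) (f y) < dist x y) : ∃ x ∈ K, Function.IsFixedPt f x := by
  have hcont : Continuous f := LipschitzWith.continuous (K := 1) <| .of_dist_le_mul fun x y => by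
    rcases eq_or_ne x y with rfl | hxy
    · simp only [dist_self, mul_zero, le_refl]
    · simpa only [NNReal.coe_one, one_mul] using (hf x y hxy).le
  obtain ⟨x, hx, hmin⟩ := hK.exists_isMinOn hne (continuous_id.dist hcont).continuousOn
  refine ⟨x, hx, by_contra fun hfix => ?_⟩
  exact (hf x (f x) (Ne.symm hfix)).not_ge (hmin (hmaps hx))

/-- Squared Mahalanobis lengths in logarithmic coordinates, as a function of the logarithms `s`
of the weights. -/
noncomputable def logMahalanobis {ι κ : Type*} [Fintype ι] [DecidableEq ι] [Fintype κ]
    [DecidableEq κ] (X : Matrix ι κ ℝ) (s : ι → ℝ) (i : ι) : ℝ :=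
  Real.log (mahalanobis X (fun j => Real.exp (s j)) i)

/-- The weight function `u` in logarithmic coordinates. -/
noncomputable def logWeight (u : ℝ → ℝ) (t : ℝ) : ℝ :=
  Real.log (u (Real.exp t))

/-- The fixed point map of Maronna's equation, acting on the logarithms of the squared
Mahalanobis lengths. -/
noncomputable def logMaronna {ι κ : Type*} [Fintype ι] [DecidableEq ι] [Fintype κ]
    [DecidableEq κ] (u : ℝ → ℝ) (X : Matrix ι κ ℝ) (t : ι → ℝ) : ι → ℝ :=
  logMahalanobis X (logWeight u ∘ t)

variable {ι κ : Type*} [Fintype ι] [DecidableEq ι] [Fintype κ] [DecidableEq κ]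
  {X : Matrix ι κ ℝ} {u : ℝ → ℝ} {y : ℝ}

theorem logMahalanobis_sub_le (hX : Function.Injective X.mulVec) (hpos : ∀ i, 0 < hatMatrix X i i)
    (s s' : ι → ℝ) (i : ι) : logMahalanobis X s' i - logMahalanobis X s i ≤ dist s s' := by
  have hweights (j : ι) : Real.exp (s j) ≤ Real.exp (dist s s') * Real.exp (s' j) := by
    rw [← Real.exp_add]
    gcongr
    linarith [(le_abs_self (s j - s' j)).trans (dist_le_pi_dist s s' j)]
  have hlengths := Real.log_le_log (mahalanobis_pos hX (fun j => Real.exp_pos _) (hpos i))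
    (mahalanobis_le_mul hX (fun j => Real.exp_pos _) (fun j => Real.exp_pos _) (Real.exp_pos _)
      hweights i)
  rw [Real.log_mul (Real.exp_pos _).ne'
    (mahalanobis_pos hX (fun j => Real.exp_pos _) (hpos i)).ne', Real.log_exp] at hlengths
  exact sub_le_iff_le_add.2 hlengths

theorem dist_logMahalanobis_le (hX : Function.Injective X.mulVec)
    (hpos : ∀ i, 0 < hatMatrix X i i) (s s' : ι → ℝ) :
    dist (logMahalanobis X s) (logMahalanobis X s') ≤ dist s s' :=
  (dist_pi_le_iff dist_nonneg).2 fun i => abs_sub_le_iff.2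
    ⟨(logMahalanobis_sub_le hX hpos s' s i).trans_eq (dist_comm _ _),
      logMahalanobis_sub_le hX hpos s s' i⟩

theorem AssumptionA2.hasDerivAt (hA2 : AssumptionA2 u) {x : ℝ} (hx : 0 < x) :
    HasDerivAt u (derivWithin u (Ici 0) x) x :=
  (hA2.differentiableOn x hx.le).hasDerivWithinAt.hasDerivAt (Ici_mem_nhds hx)

theorem AssumptionA2.strictAntiOn_div (hA2 : AssumptionA2 u) :
    StrictAntiOn (fun x => u x / x) (Ioi 0) := by
  have hderiv : ∀ x ∈ Ioi (0 : ℝ), HasDerivAt (fun x => u x / x)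
      ((derivWithin u (Ici 0) x * x - u x * 1) / x ^ 2) x := fun x hx =>
    (hA2.hasDerivAt hx).div (hasDerivAt_id x) (ne_of_gt hx)
  refine strictAntiOn_of_deriv_neg (convex_Ioi 0)
    (fun x hx => (hderiv x hx).continuousAt.continuousWithinAt) fun x hx => ?_
  rw [interior_Ioi] at hx
  rw [(hderiv x hx).deriv]
  exact div_neg_of_neg_of_pos (by linarith [hA2.mul_deriv_lt x hx.le]) (pow_pos hx 2)

theorem exp_logWeight (hA1 : AssumptionA1 u y) (t : ℝ) :
    Real.exp (logWeight u t) = u (Real.exp t) :=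
  Real.exp_log (hA1.pos _ (Real.exp_pos t).le)

theorem strictMono_maronnaPsi_exp (hA1 : AssumptionA1 u y) :
    StrictMono fun t => maronnaPsi u (Real.exp t) := fun s t hst =>
  hA1.psi_strictMonoOn (Real.exp_pos s).le (Real.exp_pos t).le (Real.exp_lt_exp.2 hst)

theorem log_maronnaPsi_exp (hA1 : AssumptionA1 u y) (t : ℝ) :
    Real.log (maronnaPsi u (Real.exp t)) = t + logWeight u t := by
  rw [maronnaPsi, ← exp_logWeight hA1, ← Real.exp_add, Real.log_exp]

theorem strictAnti_logWeight_sub (hA1 : AssumptionA1 u y) (hA2 : AssumptionA2 u) :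
    StrictAnti fun t => logWeight u t - t := by
  intro s t hst
  rw [← Real.exp_lt_exp, Real.exp_sub, Real.exp_sub, exp_logWeight hA1, exp_logWeight hA1]
  exact hA2.strictAntiOn_div (Real.exp_pos s) (Real.exp_pos t) (Real.exp_lt_exp.2 hst)

theorem dist_logWeight_lt (hA1 : AssumptionA1 u y) (hA2 : AssumptionA2 u) {s t : ℝ}
    (hst : s ≠ t) : dist (logWeight u s) (logWeight u t) < dist s t := by
  wlog hlt : s < t generalizing s t
  · rw [dist_comm, dist_comm s]
    exact this hst.symm (hst.lt_or_gt.resolve_left hlt)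
  have hadd : Real.log (maronnaPsi u (Real.exp s)) < Real.log (maronnaPsi u (Real.exp t)) :=
    Real.log_lt_log (mul_pos (Real.exp_pos s) (hA1.pos _ (Real.exp_pos s).le))
      (strictMono_maronnaPsi_exp hA1 hlt)
  rw [log_maronnaPsi_exp hA1, log_maronnaPsi_exp hA1] at hadd
  have hsub := strictAnti_logWeight_sub hA1 hA2 hlt
  rw [Real.dist_eq, dist_comm, Real.dist_eq, abs_of_pos (sub_pos.2 hlt), abs_lt]
  constructor <;> linarith

theorem dist_logMaronna_lt (hA1 : AssumptionA1 u y) (hA2 : AssumptionA2 u)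
    (hX : Function.Injective X.mulVec) (hpos : ∀ i, 0 < hatMatrix X i i) {s t : ι → ℝ}
    (hst : s ≠ t) : dist (logMaronna u X s) (logMaronna u X t) < dist s t := by
  refine (dist_logMahalanobis_le hX hpos _ _).trans_lt ((dist_pi_lt_iff (dist_pos.2 hst)).2 ?_)
  intro i
  rcases eq_or_ne (s i) (t i) with hi | hi
  · rw [Function.comp_apply, Function.comp_apply, hi, dist_self]
    exact dist_pos.2 hst
  · exact (dist_logWeight_lt hA1 hA2 hi).trans_le (dist_le_pi_dist s t i)

theorem logMaronna_const (hA1 : AssumptionA1 u y) (hX : Function.Injective X.mulVec)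
    (hpos : ∀ i, 0 < hatMatrix X i i) (c : ℝ) (i : ι) :
    logMaronna u X (fun _ => c) i =
      c + (Real.log (hatMatrix X i i) - Real.log (maronnaPsi u (Real.exp c))) := by
  rw [log_maronnaPsi_exp hA1]
  simp only [logMaronna, logMahalanobis, Function.comp_apply]
  rw [mahalanobis_const hX (Real.exp_pos _).ne', Real.log_div (hpos i).ne' (Real.exp_pos _).ne',
    Real.log_exp]
  ring

theorem isFixedPt_logMaronna_unique (hA1 : AssumptionA1 u y) (hA2 : AssumptionA2 u)
    (hX : Function.Injective X.mulVec) (hpos : ∀ i, 0 < hatMatrix X i i) {s t : ι → ℝ}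
    (hs : Function.IsFixedPt (logMaronna u X) s) (ht : Function.IsFixedPt (logMaronna u X) t) :
    s = t := by
  by_contra hst
  have hlt := dist_logMaronna_lt hA1 hA2 hX hpos hst
  rw [hs.eq, ht.eq] at hlt
  exact hlt.false

theorem isFixedPt_logMaronna_iff (hA1 : AssumptionA1 u y) (hX : Function.Injective X.mulVec)
    (hpos : ∀ i, 0 < hatMatrix X i i) {t : ι → ℝ} :
    Function.IsFixedPt (logMaronna u X) t ↔
      ∀ i, mahalanobis X (fun j => u (Real.exp (t j))) i = Real.exp (t i) := by
  rw [Function.IsFixedPt, funext_iff]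
  refine forall_congr' fun i => ?_
  simp only [logMaronna, logMahalanobis, Function.comp_apply, exp_logWeight hA1]
  rw [← Real.exp_eq_exp,
    Real.exp_log (mahalanobis_pos hX (fun j => hA1.pos _ (Real.exp_pos _).le) (hpos i))]

end LogarithmicCoordinates

section MaronnaEquation

/-- The data matrix with rows `x i`. -/
def dataMatrix {ι κ : Type*} (x : ι → EuclideanSpace ℝ κ) : Matrix ι κ ℝ :=
  Matrix.of fun i => (x i).ofLp

variable {n p : ℕ} {u : ℝ → ℝ} {y : ℝ} {x : Fin n → EuclideanSpace ℝ (Fin p)}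

theorem isMaronnaSolution_iff (hA1 : AssumptionA1 u y)
    (hX : Function.Injective (dataMatrix x).mulVec) (hpos : ∀ i, 0 < hatMatrix (dataMatrix x) i i)
    {S : Matrix (Fin p) (Fin p) ℝ} :
    IsMaronnaSolution u x S ↔ ∃ t, Function.IsFixedPt (logMaronna u (dataMatrix x)) t ∧
      S = weightedScatter (dataMatrix x) fun i => u (Real.exp (t i)) := by
  constructor
  · rintro ⟨hS, hequation⟩
    have hrow (i : Fin n) : (x i).ofLp ≠ 0 :=
      row_ne_zero_of_hatMatrix_pos (X := dataMatrix x) (hpos i)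
    have hlength (i : Fin n) : 0 < (x i).ofLp ⬝ᵥ (S⁻¹ *ᵥ (x i).ofLp) := by
      simpa only [star_trivial] using hS.inv.dotProduct_mulVec_pos (hrow i)
    have hscatter : S = weightedScatter (dataMatrix x) fun i => u (Real.exp (Real.log
        ((x i).ofLp ⬝ᵥ (S⁻¹ *ᵥ (x i).ofLp)))) := by
      simp only [Real.exp_log (hlength _)]
      rw [weightedScatter_eq_sum]
      exact hequation
    refine ⟨_, (isFixedPt_logMaronna_iff hA1 hX hpos).2 fun i => ?_, hscatter⟩
    rw [mahalanobis_eq_dotProduct, ← hscatter, Real.exp_log (hlength i)]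
    rfl
  · rintro ⟨t, ht, rfl⟩
    have hlength (i : Fin n) : (x i).ofLp ⬝ᵥ (weightedScatter (dataMatrix x) fun j =>
        u (Real.exp (t j)))⁻¹ *ᵥ (x i).ofLp = Real.exp (t i) :=
      (mahalanobis_eq_dotProduct (dataMatrix x) _ i).symm.trans
        ((isFixedPt_logMaronna_iff hA1 hX hpos).1 ht i)
    refine ⟨posDef_weightedScatter hX fun i => hA1.pos _ (Real.exp_pos _).le, ?_⟩
    simp only [hlength]
    exact weightedScatter_eq_sum (dataMatrix x) _

theorem existsUnique_isMaronnaSolution (hA1 : AssumptionA1 u y) (hA2 : AssumptionA2 u)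
    (hX : Function.Injective (dataMatrix x).mulVec) (hpos : ∀ i, 0 < hatMatrix (dataMatrix x) i i)
    {t : Fin n → ℝ} (ht : Function.IsFixedPt (logMaronna u (dataMatrix x)) t) :
    (∃! S, IsMaronnaSolution u x S) ∧
      maronnaEstimator u x = weightedScatter (dataMatrix x) fun i => u (Real.exp (t i)) := by
  have hsol := (isMaronnaSolution_iff hA1 hX hpos).2 ⟨t, ht, rfl⟩
  have huniq (S : Matrix (Fin p) (Fin p) ℝ) (hS : IsMaronnaSolution u x S) :
      S = weightedScatter (dataMatrix x) fun i => u (Real.exp (t i)) := by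
    obtain ⟨s, hs, rfl⟩ := (isMaronnaSolution_iff hA1 hX hpos).1 hS
    rw [isFixedPt_logMaronna_unique hA1 hA2 hX hpos hs ht]
  have hex : ∃ S, IsMaronnaSolution u x S := ⟨_, hsol⟩
  refine ⟨⟨_, hsol, huniq⟩, ?_⟩
  rw [maronnaEstimator, dif_pos hex]
  exact huniq _ hex.choose_spec

end MaronnaEquation

section FixedPoint

variable {ι κ : Type*} [Fintype ι] [DecidableEq ι] [Fintype κ] [DecidableEq κ]
  {X : Matrix ι κ ℝ} {u : ℝ → ℝ} {y : ℝ}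

theorem continuous_logWeight (hA1 : AssumptionA1 u y) (hA2 : AssumptionA2 u) :
    Continuous (logWeight u) :=
  LipschitzWith.continuous (K := 1) <| .of_dist_le_mul fun s t => by
    rcases eq_or_ne s t with rfl | hst
    · simp only [dist_self, mul_zero, le_refl]
    · simpa only [NNReal.coe_one, one_mul] using (dist_logWeight_lt hA1 hA2 hst).le

theorem exists_dist_logWeight_le (hA1 : AssumptionA1 u y) (hA2 : AssumptionA2 u) (c : ℝ) {r : ℝ}
    (hr : 0 < r) :
    ∃ ρ < r, ∀ t ∈ Metric.closedBall c r, dist (logWeight u t) (logWeight u c) ≤ ρ := by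
  obtain ⟨s, hs, hmax⟩ := (isCompact_closedBall c r).exists_isMaxOn
    ⟨c, Metric.mem_closedBall_self hr.le⟩
    ((continuous_logWeight hA1 hA2).dist (continuous_const (y := logWeight u c))).continuousOn
  refine ⟨dist (logWeight u s) (logWeight u c), ?_, fun t ht => hmax ht⟩
  rcases eq_or_ne s c with rfl | hsc
  · rwa [dist_self]
  · exact (dist_logWeight_lt hA1 hA2 hsc).trans_le hs

theorem dist_logMaronna_const_le (hA1 : AssumptionA1 u y) (hX : Function.Injective X.mulVec)
    (hpos : ∀ i, 0 < hatMatrix X i i) {c ρ η : ℝ} (hρ : 0 ≤ ρ) (hη : 0 ≤ η) {t : ι → ℝ}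
    (ht : ∀ i, dist (logWeight u (t i)) (logWeight u c) ≤ ρ)
    (hlev : ∀ i, dist (Real.log (hatMatrix X i i))
      (Real.log (maronnaPsi u (Real.exp c))) ≤ η) :
    dist (logMaronna u X t) (fun _ => c) ≤ ρ + η := by
  refine (dist_triangle _ (logMaronna u X fun _ => c) _).trans (add_le_add ?_ ?_)
  · exact (dist_logMahalanobis_le hX hpos _ _).trans ((dist_pi_le_iff hρ).2 ht)
  · refine (dist_pi_le_iff hη).2 fun i => ?_
    rw [logMaronna_const hA1 hX hpos, dist_self_add_left]
    exact hlev i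

/-- Since `logWeight u` strictly decreases distances, it shrinks every ball around `c` by a
definite amount; leverages close to `ψ (exp c)` move the centre by less than that. -/
theorem exists_isFixedPt_logMaronna (hA1 : AssumptionA1 u y) (hA2 : AssumptionA2 u)
    (hX : Function.Injective X.mulVec) (hpos : ∀ i, 0 < hatMatrix X i i) {c r ρ : ℝ}
    (hr : 0 ≤ r) (hρr : ρ ≤ r)
    (hρ : ∀ t ∈ Metric.closedBall c r, dist (logWeight u t) (logWeight u c) ≤ ρ)
    (hlev : ∀ i, dist (Real.log (hatMatrix X i i))
      (Real.log (maronnaPsi u (Real.exp c))) ≤ r - ρ) :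
    ∃ t ∈ Metric.closedBall (fun _ : ι => c) r, Function.IsFixedPt (logMaronna u X) t := by
  refine exists_isFixedPt_of_dist_lt (isCompact_closedBall _ r)
    ⟨_, Metric.mem_closedBall_self hr⟩ (fun t ht => ?_)
    fun s t hst => dist_logMaronna_lt hA1 hA2 hX hpos hst
  have hρ0 : 0 ≤ ρ := dist_nonneg.trans (hρ c (Metric.mem_closedBall_self hr))
  exact (dist_logMaronna_const_le hA1 hX hpos hρ0 (sub_nonneg.2 hρr)
    (fun i => hρ _ ((dist_le_pi_dist t _ i).trans ht)) hlev).trans_eq (add_sub_cancel ρ r)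

theorem dist_isFixedPt_le (hA1 : AssumptionA1 u y) (hX : Function.Injective X.mulVec)
    (hpos : ∀ i, 0 < hatMatrix X i i) {c θ η : ℝ} (hθ0 : 0 ≤ θ) (hθ : θ < 1) (hη : 0 ≤ η)
    {t : ι → ℝ} (ht : Function.IsFixedPt (logMaronna u X) t)
    (hcontr : ∀ i, dist (logWeight u (t i)) (logWeight u c) ≤ θ * dist (t i) c)
    (hlev : ∀ i, dist (Real.log (hatMatrix X i i))
      (Real.log (maronnaPsi u (Real.exp c))) ≤ η) :
    dist t (fun _ => c) ≤ η / (1 - θ) := by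
  have hself : dist t (fun _ => c) ≤ θ * dist t (fun _ => c) + η := by
    have h := dist_logMaronna_const_le hA1 hX hpos
      (mul_nonneg hθ0 (dist_nonneg (x := t) (y := fun _ => c))) hη (fun i =>
        (hcontr i).trans (mul_le_mul_of_nonneg_left (dist_le_pi_dist t (fun _ => c) i) hθ0)) hlev
    rwa [ht.eq] at h
  rw [le_div_iff₀ (sub_pos.2 hθ)]
  linarith

theorem sum_maronnaPsi_exp (hA1 : AssumptionA1 u y) (hX : Function.Injective X.mulVec)
    (hpos : ∀ i, 0 < hatMatrix X i i) {t : ι → ℝ}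
    (ht : Function.IsFixedPt (logMaronna u X) t) :
    ∑ i, maronnaPsi u (Real.exp (t i)) = Fintype.card κ := by
  rw [← sum_mul_mahalanobis (isUnit_det_weightedScatter (X := X) hX fun i =>
    hA1.pos _ (Real.exp_pos (t i)).le)]
  simp only [(isFixedPt_logMaronna_iff hA1 hX hpos).1 ht, maronnaPsi, mul_comm]

end FixedPoint

section Contraction

variable {u : ℝ → ℝ} {y c : ℝ}

theorem hasDerivAt_logWeight (hA1 : AssumptionA1 u y) (hA2 : AssumptionA2 u) (t : ℝ) :
    HasDerivAt (logWeight u)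
      (derivWithin u (Ici 0) (Real.exp t) * Real.exp t / u (Real.exp t)) t :=
  ((hA2.hasDerivAt (Real.exp_pos t)).comp t (Real.hasDerivAt_exp t)).log
    (hA1.pos _ (Real.exp_pos t).le).ne'

theorem exists_eventually_dist_logWeight_le (hA1 : AssumptionA1 u y) (hA2 : AssumptionA2 u)
    (hc : 0 < u (Real.exp c) + Real.exp c * derivWithin u (Ici 0) (Real.exp c)) :
    ∃ θ, 0 ≤ θ ∧ θ < 1 ∧
      ∀ᶠ t in 𝓝 c, dist (logWeight u t) (logWeight u c) ≤ θ * dist t c := by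
  have huc := hA1.pos _ (Real.exp_pos c).le
  have hderiv : |derivWithin u (Ici 0) (Real.exp c) * Real.exp c / u (Real.exp c)| < 1 := by
    rw [abs_lt, lt_div_iff₀ huc, div_lt_iff₀ huc]
    constructor <;> linarith [hA2.mul_deriv_lt _ (Real.exp_pos c).le]
  obtain ⟨θ, hθ, hθ1⟩ := exists_between hderiv
  refine ⟨θ, (abs_nonneg _).trans hθ.le, hθ1, ?_⟩
  have hslope := (hasDerivAt_logWeight hA1 hA2 c).hasDerivWithinAt (s := univ)
    |>.limsup_norm_slope_le hθ
  rw [nhdsWithin_univ] at hslope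
  filter_upwards [hslope] with t ht
  rcases eq_or_ne t c with rfl | htc
  · simp only [dist_self, mul_zero, le_refl]
  · rw [dist_eq_norm, dist_eq_norm]
    exact ((inv_mul_lt_iff₀' (norm_pos_iff.2 (sub_ne_zero.2 htc))).1 ht).le

end Contraction

section BalancedDesign

theorem exists_card_le_two_mul_card {ι : Type*} [Fintype ι] (w : ι → ℝ) (m : ℝ) :
    ∃ J : Finset ι, Fintype.card ι ≤ 2 * J.card ∧ ((∀ j ∈ J, m ≤ w j) ∨ ∀ j ∈ J, w j ≤ m) := by
  classical
  have hcover : (Finset.univ.filter fun i => m ≤ w i) ∪ (Finset.univ.filter fun i => w i ≤ m) =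
      Finset.univ := by
    simp only [← Finset.filter_or, le_total, Finset.filter_true]
  have hcard := Finset.card_union_le (Finset.univ.filter fun i => m ≤ w i)
    (Finset.univ.filter fun i => w i ≤ m)
  rw [hcover, Finset.card_univ] at hcard
  rcases le_total (Finset.univ.filter fun i => m ≤ w i).card
    (Finset.univ.filter fun i => w i ≤ m).card with h | h
  · exact ⟨Finset.univ.filter fun i => w i ≤ m, by omega,
      .inr fun j hj => (Finset.mem_filter.1 hj).2⟩
  · exact ⟨Finset.univ.filter fun i => m ≤ w i, by omega,
      .inl fun j hj => (Finset.mem_filter.1 hj).2⟩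

/-- A design of full column rank whose leverages are `ε`-close to their mean value and whose hat
matrix puts, in every row, squared mass at least `α` on every set of at least half of the
indices. -/
structure IsBalancedDesign {ι κ : Type*} [Fintype ι] [Fintype κ] [DecidableEq κ]
    (X : Matrix ι κ ℝ) (α ε : ℝ) : Prop where
  injective : Function.Injective X.mulVec
  abs_leverage_sub_le : ∀ i, |hatMatrix X i i - (Fintype.card κ : ℝ) / Fintype.card ι| ≤ ε
  le_sum_sq : ∀ i (J : Finset ι), Fintype.card ι ≤ 2 * J.card → α ≤ ∑ j ∈ J, hatMatrix X i j ^ 2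

variable {ι κ : Type*} [Fintype ι] [DecidableEq ι] [Fintype κ] [DecidableEq κ]
  {X : Matrix ι κ ℝ} {w : ι → ℝ} {α ε : ℝ}

theorem mul_mahalanobis_le_of_weights_ge (hX : Function.Injective X.mulVec) {a b : ℝ} (ha : 0 < a)
    (hw : ∀ j, a ≤ w j) {J : Finset ι} (hb : 0 < b) (hJ : ∀ j ∈ J, b ≤ w j) (i : ι) :
    a * mahalanobis X w i ≤
      hatMatrix X i i - (∑ j ∈ J, hatMatrix X i j ^ 2) * (1 - a / b) := by
  have hterm (j : ι) : a * (hatMatrix X i j ^ 2 / w j) ≤ hatMatrix X i j ^ 2 -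
      if j ∈ J then hatMatrix X i j ^ 2 * (1 - a / b) else 0 := by
    have hwj : 0 < w j := ha.trans_le (hw j)
    rw [mul_div_left_comm]
    split_ifs with hj
    · rw [← mul_one_sub, sub_sub_cancel]
      gcongr
      exact hJ j hj
    · rw [sub_zero]
      exact mul_le_of_le_one_right (sq_nonneg _) ((div_le_one hwj).2 (hw j))
  have hsum := Finset.sum_le_sum fun j (_ : j ∈ Finset.univ) => hterm j
  rw [← Finset.mul_sum, Finset.sum_sub_distrib, sum_hatMatrix_sq hX, Finset.sum_ite_mem,
    Finset.univ_inter, ← Finset.sum_mul] at hsum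
  exact (mul_le_mul_of_nonneg_left (mahalanobis_le_sum hX (fun j => ha.trans_le (hw j)) i)
    ha.le).trans hsum

theorem le_mul_mahalanobis_of_weights_le (hX : Function.Injective X.mulVec) {a b : ℝ} (ha : 0 < a)
    (hw0 : ∀ j, 0 < w j) (hw : ∀ j, w j ≤ a) {J : Finset ι} (hJ : ∀ j ∈ J, w j ≤ b) (i : ι) :
    hatMatrix X i i + (∑ j ∈ J, hatMatrix X i j ^ 2) * (1 - b / a) ≤ a * mahalanobis X w i := by
  have hterm (j : ι) : a⁻¹ * (w j * hatMatrix X i j ^ 2) ≤ hatMatrix X i j ^ 2 -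
      if j ∈ J then hatMatrix X i j ^ 2 * (1 - b / a) else 0 := by
    rw [← mul_assoc, inv_mul_eq_div, mul_comm (w j / a)]
    split_ifs with hj
    · rw [← mul_one_sub, sub_sub_cancel]
      gcongr
      exact hJ j hj
    · rw [sub_zero]
      exact mul_le_of_le_one_right (sq_nonneg _) ((div_le_one ha).2 (hw j))
  have hsum := Finset.sum_le_sum fun j (_ : j ∈ Finset.univ) => hterm j
  rw [← Finset.mul_sum, Finset.sum_sub_distrib, sum_hatMatrix_sq hX, Finset.sum_ite_mem,
    Finset.univ_inter, ← Finset.sum_mul] at hsum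
  have hlower := mul_le_mul_of_nonneg_left (le_mahalanobis hX hw0 1 a⁻¹ i) ha.le
  rw [weightedHat_one, mahalanobis, weightedHat_one] at hlower
  have hexpand : a * (2 * a⁻¹ * hatMatrix X i i - a⁻¹ ^ 2 * ∑ j, w j * hatMatrix X i j ^ 2) =
      2 * hatMatrix X i i - a⁻¹ * ∑ j, w j * hatMatrix X i j ^ 2 := by
    field_simp
  linarith

/-- Half of the weights lie on one side of the midpoint of the extreme ones, and by the mass that
the hat matrix puts there they push the Mahalanobis length at the opposite extreme away from the
leverage. -/
theorem IsBalancedDesign.weight_le_mul (hX : IsBalancedDesign X α ε) (hε : 0 < ε) (hεα : 4 * ε ≤ α)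
    (hw : ∀ i, 0 < w i) {k l : ι} (hk : ∀ i, w k ≤ w i) (hl : ∀ i, w i ≤ w l)
    (hqk : (Fintype.card κ : ℝ) / Fintype.card ι ≤ w k * mahalanobis X w k)
    (hql : w l * mahalanobis X w l ≤ (Fintype.card κ : ℝ) / Fintype.card ι) :
    w l ≤ (1 + 4 * (ε / α)) * w k := by
  have hα : 0 < α := by linarith
  have hratio : ε / α ≤ 1 / 4 := by
    rw [div_le_iff₀ hα]
    linarith
  have hstep {s v : ℝ} (hs : α ≤ s) (hv : v ≤ 1) (hsv : s * (1 - v) ≤ ε) : 1 - ε / α ≤ v := by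
    rw [sub_le_comm, le_div_iff₀ hα, mul_comm]
    exact (mul_le_mul_of_nonneg_right hs (sub_nonneg.2 hv)).trans hsv
  have hkl : w k ≤ (w k + w l) / 2 := by linarith [hk l]
  have hml : (w k + w l) / 2 ≤ w l := by linarith [hk l]
  have hmid : 0 < (w k + w l) / 2 := (hw k).trans_le hkl
  obtain ⟨J, hcard, hJ | hJ⟩ := exists_card_le_two_mul_card w ((w k + w l) / 2)
  · have hlength := mul_mahalanobis_le_of_weights_ge hX.injective (hw k) hk hmid hJ k
    have h := hstep (hX.le_sum_sq k J hcard) ((div_le_one hmid).2 hkl)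
      (by linarith [(abs_le.1 (hX.abs_leverage_sub_le k)).2])
    rw [le_div_iff₀ hmid] at h
    nlinarith [mul_pos (div_pos hε hα) (hw k)]
  · have hlength := le_mul_mahalanobis_of_weights_le hX.injective (hw l) hw hl hJ l
    have h := hstep (hX.le_sum_sq l J hcard) ((div_le_one (hw l)).2 hml)
      (by linarith [(abs_le.1 (hX.abs_leverage_sub_le l)).1])
    rw [le_div_iff₀ (hw l)] at h
    nlinarith [mul_pos (div_pos hε hα) (hw k)]

end BalancedDesign

section WeightRate

variable {u : ℝ → ℝ} {y c α : ℝ}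

/-- For balanced designs with aspect ratio near `ψ (exp c)`, the weights at a fixed point of
`logMaronna u` within distance `r` of the constant `c` are `u (exp c)` up to a relative error
`K * ε`. -/
def HasWeightRate (u : ℝ → ℝ) (c α r K : ℝ) : Prop :=
  ∀ᶠ ε in 𝓝[>] 0, ∀ᶠ q in 𝓝 (maronnaPsi u (Real.exp c)),
    ∀ (n p : ℕ) (X : Matrix (Fin n) (Fin p) ℝ), (p : ℝ) / n = q → IsBalancedDesign X α ε →
      ∀ t ∈ Metric.closedBall (fun _ => c) r, Function.IsFixedPt (logMaronna u X) t →
        ∀ i, |u (Real.exp (t i)) / u (Real.exp c) - 1| ≤ K * ε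

theorem eventually_eventually_forall_abs_sub_le {P : ℝ → Prop} (hP : ∀ᶠ a in 𝓝 y, P a) :
    ∀ᶠ ε in 𝓝[>] (0 : ℝ), ∀ᶠ q in 𝓝 y, ∀ a, |a - q| ≤ ε → P a := by
  obtain ⟨δ, hδ, hball⟩ := Metric.eventually_nhds_iff.1 hP
  filter_upwards [Ioo_mem_nhdsGT (half_pos hδ)] with ε hε
  filter_upwards [Metric.ball_mem_nhds y (half_pos hδ)] with q hq a ha
  refine hball ((dist_triangle a q y).trans_lt ?_)
  rw [Real.dist_eq]
  linarith [hε.2, Metric.mem_ball.1 hq]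

theorem maronnaPsi_exp_pos (hA1 : AssumptionA1 u y) (t : ℝ) : 0 < maronnaPsi u (Real.exp t) :=
  mul_pos (Real.exp_pos t) (hA1.pos _ (Real.exp_pos t).le)

theorem div_eq_exp_logWeight_sub (hA1 : AssumptionA1 u y) (t c : ℝ) :
    u (Real.exp t) / u (Real.exp c) = Real.exp (logWeight u t - logWeight u c) := by
  rw [Real.exp_sub, exp_logWeight hA1, exp_logWeight hA1]

theorem exists_eventually_dist_log_le {a : ℝ} (ha : 0 < a) :
    ∃ C > 0, ∀ᶠ b in 𝓝 a, dist (Real.log b) (Real.log a) ≤ C * dist b a := by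
  obtain ⟨C, hC, hbound⟩ := (Real.hasDerivAt_log ha.ne').differentiableAt.isBigO_sub.exists_pos
  refine ⟨C, hC, hbound.bound.mono fun b hb => ?_⟩
  rwa [dist_eq_norm, dist_eq_norm]

theorem exists_hasWeightRate_of_contraction (hA1 : AssumptionA1 u y) (hA2 : AssumptionA2 u)
    (hc : 0 < u (Real.exp c) + Real.exp c * derivWithin u (Ici 0) (Real.exp c)) (α : ℝ) :
    ∃ r > 0, ∃ K > 0, HasWeightRate u c α r K := by
  have hψ := maronnaPsi_exp_pos hA1 c
  obtain ⟨θ, hθ0, hθ1, hcontr⟩ := exists_eventually_dist_logWeight_le hA1 hA2 hc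
  obtain ⟨r, hr, hball⟩ := Metric.nhds_basis_closedBall.eventually_iff.1 hcontr
  obtain ⟨C, hC, hlog⟩ := exists_eventually_dist_log_le hψ
  refine ⟨min r 1, lt_min hr one_pos, 2 * (C * 2 / (1 - θ)),
    mul_pos two_pos (div_pos (mul_pos hC two_pos) (sub_pos.2 hθ1)), ?_⟩
  filter_upwards [eventually_eventually_forall_abs_sub_le (hlog.and (lt_mem_nhds hψ)),
    self_mem_nhdsWithin] with ε hlev hε
  filter_upwards [hlev, Metric.closedBall_mem_nhds _ hε] with q hlev hq n p X hpn hX t ht hfix i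
  have hdist (i : Fin n) : |hatMatrix X i i - q| ≤ ε := by
    simpa only [Fintype.card_fin, hpn] using hX.abs_leverage_sub_le i
  have hti (i : Fin n) : dist (t i) c ≤ min r 1 := (dist_le_pi_dist t _ i).trans ht
  have hlevel (i : Fin n) :
      dist (Real.log (hatMatrix X i i)) (Real.log (maronnaPsi u (Real.exp c))) ≤ C * 2 * ε := by
    refine (hlev _ (hdist i)).1.trans ?_
    rw [mul_assoc, two_mul]
    exact mul_le_mul_of_nonneg_left ((dist_triangle _ q _).trans (add_le_add (hdist i) hq)) hC.le
  have hlogs := dist_isFixedPt_le hA1 hX.injective (fun i => (hlev _ (hdist i)).2) hθ0 hθ1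
    (mul_nonneg (mul_nonneg hC.le two_pos.le) (le_of_lt hε)) hfix
    (fun i => hball ((hti i).trans (min_le_left _ _))) hlevel
  have hweight : |logWeight u (t i) - logWeight u c| ≤ dist (t i) c :=
    (hball ((hti i).trans (min_le_left _ _))).trans (mul_le_of_le_one_left dist_nonneg hθ1.le)
  rw [div_eq_exp_logWeight_sub hA1]
  refine (Real.abs_exp_sub_one_le (hweight.trans ((hti i).trans (min_le_right _ _)))).trans ?_
  rw [mul_assoc, div_mul_eq_mul_div]
  exact mul_le_mul_of_nonneg_left
    (hweight.trans ((dist_le_pi_dist t (fun _ => c) i).trans hlogs)) two_pos.le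

theorem exists_antitoneOn_comp_exp (hA2 : AssumptionA2 u)
    (hc : derivWithin u (Ici 0) (Real.exp c) < 0) :
    ∃ r > 0, AntitoneOn (fun t => u (Real.exp t)) (Metric.closedBall c r) := by
  have hneg : ∀ᶠ t in 𝓝 c, derivWithin u (Ici 0) (Real.exp t) < 0 :=
    (((hA2.differentiableOn_deriv _ (Real.exp_pos c).le).continuousWithinAt.continuousAt
      (Ici_mem_nhds (Real.exp_pos c))).comp Real.continuous_exp.continuousAt).eventually_lt_const hc
  obtain ⟨r, hr, hball⟩ := Metric.nhds_basis_closedBall.eventually_iff.1 hneg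
  have hderiv (t : ℝ) := (hA2.hasDerivAt (Real.exp_pos t)).comp t (Real.hasDerivAt_exp t)
  refine ⟨r, hr, antitoneOn_of_deriv_nonpos (convex_closedBall c r)
    (fun t _ => (hderiv t).continuousAt.continuousWithinAt)
    (fun t _ => (hderiv t).differentiableAt.differentiableWithinAt) fun t ht => ?_⟩
  exact (hderiv t).deriv.trans_le
    (mul_nonpos_of_nonpos_of_nonneg (hball (interior_subset ht)).le (Real.exp_pos t).le)

theorem eventually_le_weight (hA1 : AssumptionA1 u y) (hA2 : AssumptionA2 u) {r : ℝ} (hr : 0 < r)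
    (hanti : AntitoneOn (fun t => u (Real.exp t)) (Metric.closedBall c r)) {a : ℝ}
    (ha : a < u (Real.exp c)) :
    ∀ᶠ q in 𝓝 (maronnaPsi u (Real.exp c)), ∀ t ∈ Metric.closedBall c r,
      maronnaPsi u (Real.exp t) ≤ q → a ≤ u (Real.exp t) := by
  have hcont : ContinuousAt (fun t => u (Real.exp t)) c :=
    (hA2.hasDerivAt (Real.exp_pos c)).continuousAt.comp Real.continuous_exp.continuousAt
  obtain ⟨s, ⟨has, hsr⟩, hcs⟩ := ((((hcont.eventually_const_lt ha).and
    (Metric.closedBall_mem_nhds c hr)).filter_mono nhdsWithin_le_nhds).and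
      (self_mem_nhdsWithin (s := Ioi c))).exists
  filter_upwards [gt_mem_nhds (strictMono_maronnaPsi_exp hA1 hcs)] with q hq t ht htq
  exact has.le.trans (hanti ht hsr ((strictMono_maronnaPsi_exp hA1).lt_iff_lt.1
    (htq.trans_lt hq)).le)

theorem eventually_weight_le (hA1 : AssumptionA1 u y) (hA2 : AssumptionA2 u) {r : ℝ} (hr : 0 < r)
    (hanti : AntitoneOn (fun t => u (Real.exp t)) (Metric.closedBall c r)) {a : ℝ}
    (ha : u (Real.exp c) < a) :
    ∀ᶠ q in 𝓝 (maronnaPsi u (Real.exp c)), ∀ t ∈ Metric.closedBall c r,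
      q ≤ maronnaPsi u (Real.exp t) → u (Real.exp t) ≤ a := by
  have hcont : ContinuousAt (fun t => u (Real.exp t)) c :=
    (hA2.hasDerivAt (Real.exp_pos c)).continuousAt.comp Real.continuous_exp.continuousAt
  obtain ⟨s, ⟨has, hsr⟩, hsc⟩ := ((((hcont.eventually_lt_const ha).and
    (Metric.closedBall_mem_nhds c hr)).filter_mono nhdsWithin_le_nhds).and
      (self_mem_nhdsWithin (s := Iio c))).exists
  filter_upwards [lt_mem_nhds (strictMono_maronnaPsi_exp hA1 hsc)] with q hq t ht htq
  exact (hanti hsr ht ((strictMono_maronnaPsi_exp hA1).lt_iff_lt.1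
    (hq.trans_le htq)).le).trans has.le

theorem exists_min_maronnaPsi_exp_le {ι κ : Type*} [Fintype ι] [DecidableEq ι] [Fintype κ]
    [DecidableEq κ] [Nonempty ι] {X : Matrix ι κ ℝ} (hA1 : AssumptionA1 u y)
    (hX : Function.Injective X.mulVec) (hpos : ∀ i, 0 < hatMatrix X i i) {t : ι → ℝ}
    (ht : Function.IsFixedPt (logMaronna u X) t) :
    ∃ l, (∀ i, t l ≤ t i) ∧
      maronnaPsi u (Real.exp (t l)) ≤ (Fintype.card κ : ℝ) / Fintype.card ι := by
  obtain ⟨l, hl⟩ := Finite.exists_min t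
  refine ⟨l, hl, ?_⟩
  rw [le_div_iff₀' (Nat.cast_pos.2 Fintype.card_pos), ← sum_maronnaPsi_exp hA1 hX hpos ht,
    ← nsmul_eq_mul]
  exact Finset.card_nsmul_le_sum _ _ _ fun i _ => (strictMono_maronnaPsi_exp hA1).monotone (hl i)

theorem exists_max_le_maronnaPsi_exp {ι κ : Type*} [Fintype ι] [DecidableEq ι] [Fintype κ]
    [DecidableEq κ] [Nonempty ι] {X : Matrix ι κ ℝ} (hA1 : AssumptionA1 u y)
    (hX : Function.Injective X.mulVec) (hpos : ∀ i, 0 < hatMatrix X i i) {t : ι → ℝ}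
    (ht : Function.IsFixedPt (logMaronna u X) t) :
    ∃ k, (∀ i, t i ≤ t k) ∧
      (Fintype.card κ : ℝ) / Fintype.card ι ≤ maronnaPsi u (Real.exp (t k)) := by
  obtain ⟨k, hk⟩ := Finite.exists_max t
  refine ⟨k, hk, ?_⟩
  rw [div_le_iff₀' (Nat.cast_pos.2 Fintype.card_pos), ← sum_maronnaPsi_exp hA1 hX hpos ht,
    ← nsmul_eq_mul]
  exact Finset.sum_le_card_nsmul _ _ _ fun i _ => (strictMono_maronnaPsi_exp hA1).monotone (hk i)

theorem abs_div_sub_one_le {a b ε ρ : ℝ} (hb : 0 < b) (hε : ε ∈ Icc 0 1) (hρ : 0 ≤ ρ)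
    (hupper : a ≤ (1 + ρ) * ((1 + ε) * b)) (hlower : (1 - ε) * b ≤ (1 + ρ) * a) :
    |a / b - 1| ≤ ε + 2 * ρ := by
  obtain ⟨v, rfl⟩ : ∃ v, a = v * b := ⟨a / b, (div_mul_cancel₀ a hb.ne').symm⟩
  rw [mul_div_cancel_right₀ _ hb.ne']
  have hv : v ≤ (1 + ρ) * (1 + ε) := le_of_mul_le_mul_right (by linarith) hb
  have hv' : 1 - ε ≤ (1 + ρ) * v := le_of_mul_le_mul_right (by linarith) hb
  rw [abs_le]
  constructor
  · have : (1 + ρ) * (1 - ε - ρ) ≤ (1 + ρ) * v :=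
      hv'.trans' (by nlinarith [mul_nonneg hρ hε.1, mul_nonneg hρ hρ])
    linarith [le_of_mul_le_mul_left this (by positivity)]
  · linarith [mul_le_of_le_one_right hρ hε.2]

/-- The aspect ratio lies between the values of `ψ` at the extreme squared Mahalanobis lengths, so
`u (exp c)` lies, up to a relative error `ε`, between the corresponding extreme weights; these
differ by a factor close to one. -/
theorem exists_hasWeightRate_of_deriv_neg (hA1 : AssumptionA1 u y) (hA2 : AssumptionA2 u)
    (hc : derivWithin u (Ici 0) (Real.exp c) < 0) (hα : 0 < α) :
    ∃ r > 0, ∃ K > 0, HasWeightRate u c α r K := by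
  obtain ⟨r, hr, hanti⟩ := exists_antitoneOn_comp_exp hA2 hc
  have huc := hA1.pos _ (Real.exp_pos c).le
  refine ⟨r, hr, 1 + 8 / α, by positivity, ?_⟩
  filter_upwards [eventually_eventually_forall_abs_sub_le (lt_mem_nhds (maronnaPsi_exp_pos hA1 c)),
    Ioc_mem_nhdsGT one_pos, Ioc_mem_nhdsGT (show 0 < α / 4 by positivity)] with ε hpos hε1 hεα
  have hε : 0 < ε := hε1.1
  filter_upwards [hpos,
    eventually_le_weight hA1 hA2 hr hanti (a := (1 - ε) * u (Real.exp c)) (by nlinarith),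
    eventually_weight_le hA1 hA2 hr hanti (a := (1 + ε) * u (Real.exp c)) (by nlinarith)]
    with q hpos hlower hupper n p X hpn hX t ht hfix i
  have hpos (i : Fin n) : 0 < hatMatrix X i i :=
    hpos _ (by simpa only [Fintype.card_fin, hpn] using hX.abs_leverage_sub_le i)
  have hti (i : Fin n) : t i ∈ Metric.closedBall c r := (dist_le_pi_dist t _ i).trans ht
  have : Nonempty (Fin n) := ⟨i⟩
  obtain ⟨l, hl, hql⟩ := exists_min_maronnaPsi_exp_le hA1 hX.injective hpos hfix
  obtain ⟨k, hk, hqk⟩ := exists_max_le_maronnaPsi_exp hA1 hX.injective hpos hfix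
  have hlength (j : Fin n) : u (Real.exp (t j)) *
      mahalanobis X (fun j => u (Real.exp (t j))) j = maronnaPsi u (Real.exp (t j)) := by
    rw [(isFixedPt_logMaronna_iff hA1 hX.injective hpos).1 hfix, maronnaPsi, mul_comm]
  have hratio := hX.weight_le_mul hε (by linarith [hεα.2])
    (w := fun j => u (Real.exp (t j))) (fun j => hA1.pos _ (Real.exp_pos _).le)
    (fun j => hanti (hti j) (hti k) (hk j)) (fun j => hanti (hti l) (hti j) (hl j))
    (hqk.trans_eq (hlength k).symm) ((hlength l).trans_le hql)
  rw [Fintype.card_fin, Fintype.card_fin, hpn] at hql hqk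
  have hbound := abs_div_sub_one_le (ρ := 4 * (ε / α)) huc ⟨hε.le, hε1.2⟩ (by positivity)
    ((hanti (hti l) (hti i) (hl i)).trans (hratio.trans
      (mul_le_mul_of_nonneg_left (hupper _ (hti k) hqk) (by positivity))))
    ((hlower _ (hti l) hql).trans (hratio.trans
      (mul_le_mul_of_nonneg_left (hanti (hti i) (hti k) (hk i)) (by positivity))))
  exact hbound.trans_eq (by ring)

theorem exists_hasWeightRate (hA1 : AssumptionA1 u y) (hA2 : AssumptionA2 u) (c : ℝ)
    (hα : 0 < α) : ∃ r > 0, ∃ K > 0, HasWeightRate u c α r K := by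
  rcases lt_or_ge 0 (u (Real.exp c) + Real.exp c * derivWithin u (Ici 0) (Real.exp c)) with h | h
  · exact exists_hasWeightRate_of_contraction hA1 hA2 h α
  · refine exists_hasWeightRate_of_deriv_neg hA1 hA2 (lt_of_not_ge fun hnonneg => ?_) hα
    linarith [hA1.pos _ (Real.exp_pos c).le, mul_nonneg (Real.exp_pos c).le hnonneg]

theorem exists_eventually_isFixedPt_weight (hA1 : AssumptionA1 u y) (hA2 : AssumptionA2 u) (c : ℝ)
    (hα : 0 < α) :
    ∃ K > 0, ∀ᶠ ε in 𝓝[>] 0, ∀ᶠ q in 𝓝 (maronnaPsi u (Real.exp c)),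
      ∀ (n p : ℕ) (X : Matrix (Fin n) (Fin p) ℝ), (p : ℝ) / n = q → IsBalancedDesign X α ε →
        (∀ i, 0 < hatMatrix X i i) ∧ ∃ t, Function.IsFixedPt (logMaronna u X) t ∧
          ∀ i, |u (Real.exp (t i)) / u (Real.exp c) - 1| ≤ K * ε := by
  obtain ⟨r, hr, K, hK, hrate⟩ := exists_hasWeightRate hA1 hA2 c hα
  obtain ⟨ρ, hρr, hρ⟩ := exists_dist_logWeight_le hA1 hA2 c hr
  have hψ := maronnaPsi_exp_pos hA1 c
  have hlog : ∀ᶠ a in 𝓝 (maronnaPsi u (Real.exp c)), 0 < a ∧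
      dist (Real.log a) (Real.log (maronnaPsi u (Real.exp c))) ≤ r - ρ :=
    (lt_mem_nhds hψ).and ((Real.continuousAt_log hψ.ne').eventually
      (Metric.closedBall_mem_nhds _ (sub_pos.2 hρr)))
  refine ⟨K, hK, ?_⟩
  filter_upwards [hrate, eventually_eventually_forall_abs_sub_le hlog] with ε hrate hlev
  filter_upwards [hrate, hlev] with q hrate hlev n p X hpn hX
  have hlev (i : Fin n) := hlev (hatMatrix X i i)
    (by simpa only [Fintype.card_fin, hpn] using hX.abs_leverage_sub_le i)
  obtain ⟨t, ht, hfix⟩ := exists_isFixedPt_logMaronna hA1 hA2 hX.injective (fun i => (hlev i).1)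
    hr.le hρr.le hρ fun i => (hlev i).2
  exact ⟨fun i => (hlev i).1, t, hfix, hrate n p X hpn hX t ht hfix⟩

end WeightRate

section MaronnaClose

/-- Maronna's estimator exists, is unique, and after scaling lies within `ε` of the sample
covariance matrix. -/
def MaronnaClose {n p : ℕ} (u : ℝ → ℝ) (y ε : ℝ) (x : Fin n → EuclideanSpace ℝ (Fin p)) : Prop :=
  (∃! S, IsMaronnaSolution u x S) ∧ maronnaError u y x ≤ ε

variable {u : ℝ → ℝ} {y : ℝ}

theorem maronnaPsiInv_spec (hy : 0 < y) (hA1 : AssumptionA1 u y) (hA2 : AssumptionA2 u) :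
    0 < maronnaPsiInv u y ∧ maronnaPsi u (maronnaPsiInv u y) = y := by
  obtain ⟨L, hL, hyL⟩ := hA1.lim_psi
  obtain ⟨b, hb, hb0⟩ := ((hL.eventually_const_lt hyL).and (eventually_ge_atTop 0)).exists
  have hzero : maronnaPsi u 0 = 0 := zero_mul _
  have hcont : ContinuousOn (maronnaPsi u) (Icc 0 b) :=
    (continuousOn_id.mul hA2.differentiableOn.continuousOn).mono Icc_subset_Ici_self
  have hmem : y ∈ Icc (maronnaPsi u 0) (maronnaPsi u b) :=
    ⟨hzero.trans_le hy.le, (EReal.coe_lt_coe_iff.1 hb).le⟩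
  obtain ⟨d, hd, hdy⟩ := intermediate_value_Icc hb0 hcont hmem
  have hex : ∃ a ∈ Ici (0 : ℝ), maronnaPsi u a = y := ⟨d, hd.1, hdy⟩
  have hinv : maronnaPsi u (maronnaPsiInv u y) = y := Function.invFunOn_eq hex
  refine ⟨lt_of_le_of_ne (Function.invFunOn_mem hex) fun h => hy.ne ?_, hinv⟩
  rw [← hinv, ← h, hzero]

theorem maronnaPsiInv_div_eq (hy : 0 < y) (hA1 : AssumptionA1 u y) (hA2 : AssumptionA2 u) (n : ℝ) :
    maronnaPsiInv u y / (n * y) = 1 / n * (u (maronnaPsiInv u y))⁻¹ := by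
  obtain ⟨hd, hdy⟩ := maronnaPsiInv_spec hy hA1 hA2
  calc maronnaPsiInv u y / (n * y)
      = maronnaPsiInv u y / (n * maronnaPsi u (maronnaPsiInv u y)) := by rw [hdy]
    _ = 1 / n * (u (maronnaPsiInv u y))⁻¹ := by
        rw [maronnaPsi]
        field_simp

theorem maronnaError_le (hy : 0 < y) (hA1 : AssumptionA1 u y) (hA2 : AssumptionA2 u) {n p : ℕ}
    (hn : 0 < n) {x : Fin n → EuclideanSpace ℝ (Fin p)} {w : Fin n → ℝ}
    (hw : maronnaEstimator u x = weightedScatter (dataMatrix x) w) {a T : ℝ} (ha : 0 ≤ a)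
    (hclose : ∀ i, |w i / u (maronnaPsiInv u y) - 1| ≤ a) (hT : ‖dataMatrix x‖ ^ 2 ≤ T * n) :
    maronnaError u y x ≤ a * T := by
  have hcov : sampleCov x = (1 / (n : ℝ)) • weightedScatter (dataMatrix x) 1 := by
    rw [sampleCov, weightedScatter_eq_sum]
    simp only [Pi.one_apply, one_smul]
    rfl
  have hnorm : ‖(u (maronnaPsiInv u y))⁻¹ • w - 1‖ ≤ a := by
    refine (pi_norm_le_iff_of_nonneg ha).2 fun i => ?_
    simpa only [Pi.sub_apply, Pi.smul_apply, smul_eq_mul, Pi.one_apply, inv_mul_eq_div,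
      Real.norm_eq_abs] using hclose i
  have : (0 : ℝ) < n := Nat.cast_pos.2 hn
  rw [maronnaError, hw, hcov, maronnaPsiInv_div_eq hy hA1 hA2, mul_smul, ← smul_sub,
    ← weightedScatter_smul, weightedScatter_sub, norm_smul, Real.norm_of_nonneg (by positivity)]
  calc 1 / (n : ℝ) * ‖weightedScatter (dataMatrix x) ((u (maronnaPsiInv u y))⁻¹ • w - 1)‖
      ≤ 1 / n * (a * (T * n)) := by
        gcongr
        exact (norm_weightedScatter_le _ _).trans (mul_le_mul hnorm hT (by positivity) ha)
    _ = a * T := by field_simp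

theorem exists_eventually_maronnaClose (hy : 0 < y) (hA1 : AssumptionA1 u y)
    (hA2 : AssumptionA2 u) {α T : ℝ} (hα : 0 < α) (hT : 0 < T) :
    ∃ K > 0, ∀ᶠ ε in 𝓝[>] 0, ∀ᶠ q in 𝓝 y,
      ∀ (n p : ℕ) (x : Fin n → EuclideanSpace ℝ (Fin p)), 0 < n → (p : ℝ) / n = q →
        IsBalancedDesign (dataMatrix x) α ε → ‖dataMatrix x‖ ^ 2 ≤ T * n →
          MaronnaClose u y (K * ε) x := by
  obtain ⟨hd, hdy⟩ := maronnaPsiInv_spec hy hA1 hA2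
  obtain ⟨K, hK, hclose⟩ :=
    exists_eventually_isFixedPt_weight hA1 hA2 (Real.log (maronnaPsiInv u y)) hα
  rw [Real.exp_log hd, hdy] at hclose
  refine ⟨K * T, mul_pos hK hT, ?_⟩
  filter_upwards [hclose, self_mem_nhdsWithin] with ε hclose hε
  filter_upwards [hclose] with q hclose n p x hn hpn hx hxT
  obtain ⟨hpos, t, ht, hweight⟩ := hclose n p (dataMatrix x) hpn hx
  obtain ⟨hunique, hest⟩ := existsUnique_isMaronnaSolution hA1 hA2 hx.injective hpos ht
  refine ⟨hunique, ?_⟩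
  rw [mul_right_comm]
  exact maronnaError_le hy hA1 hA2 hn hest (mul_nonneg hK.le (le_of_lt hε)) hweight hxT

end MaronnaClose

section GaussianQuadraticForms

theorem gaussianPDFReal_mul_exp_mul_sq (a x : ℝ) :
    gaussianPDFReal 0 1 x * Real.exp (a * x ^ 2) =
      (√(2 * Real.pi))⁻¹ * Real.exp (-(1 / 2 - a) * x ^ 2) := by
  rw [gaussianPDFReal_def]
  simp only [NNReal.coe_one, mul_one, sub_zero]
  rw [mul_assoc, ← Real.exp_add]
  congr 2
  ring

theorem integrable_exp_mul_sq_gaussianReal {a : ℝ} (ha : a < 1 / 2) :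
    Integrable (fun x : ℝ => Real.exp (a * x ^ 2)) (gaussianReal 0 1) := by
  rw [gaussianReal_of_var_ne_zero _ one_ne_zero,
    integrable_withDensity_iff_integrable_smul' (measurable_gaussianPDF _ _)
      (ae_of_all _ fun _ => gaussianPDF_lt_top)]
  simp only [toReal_gaussianPDF, smul_eq_mul, gaussianPDFReal_mul_exp_mul_sq]
  exact (integrable_exp_neg_mul_sq (sub_pos.2 ha)).const_mul _

theorem integral_exp_mul_sq_gaussianReal {a : ℝ} (ha : a < 1 / 2) :
    ∫ x, Real.exp (a * x ^ 2) ∂(gaussianReal 0 1) = (√(1 - 2 * a))⁻¹ := by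
  rw [integral_gaussianReal_eq_integral_smul one_ne_zero]
  simp only [smul_eq_mul, gaussianPDFReal_mul_exp_mul_sq]
  rw [integral_const_mul, integral_gaussian, ← Real.sqrt_inv, ← Real.sqrt_inv,
    ← Real.sqrt_mul (by positivity)]
  have hne : 1 - 2 * a ≠ 0 := by linarith
  rw [show 1 / 2 - a = (1 - 2 * a) / 2 by ring]
  congr 1
  field_simp

theorem inv_sqrt_one_sub_le {a : ℝ} (ha : |a| ≤ 1 / 4) :
    (√(1 - 2 * a))⁻¹ ≤ Real.exp (a + 4 * a ^ 2) := by
  have ha' := abs_le.1 ha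
  have hpos : 0 < 1 - 2 * a := by linarith
  have hsquare : (1 - 2 * a)⁻¹ ≤ Real.exp (a + 4 * a ^ 2) ^ 2 := by
    rw [← Real.exp_nat_mul]
    refine le_trans ?_ (Real.add_one_le_exp _)
    rw [inv_le_iff_one_le_mul₀ hpos]
    push_cast
    nlinarith [mul_nonneg (sq_nonneg a) (show 0 ≤ 1 - 4 * a by linarith)]
  rw [← Real.sqrt_inv]
  exact (Real.sqrt_le_sqrt hsquare).trans_eq (Real.sqrt_sq (Real.exp_pos _).le)

theorem measure_pi_le_sum_mul_sq_le {ι : Type*} [Fintype ι] {α : ι → Type*}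
    [∀ i, MeasurableSpace (α i)] (μ : ∀ i, Measure (α i)) [∀ i, IsProbabilityMeasure (μ i)]
    {f : ∀ i, α i → ℝ} (hf : ∀ i, MeasurePreserving (f i) (μ i) (gaussianReal 0 1)) {a : ι → ℝ}
    (ha : ∀ i, a i < 1 / 2) (b : ℝ) :
    Measure.pi μ {x | b ≤ ∑ i, a i * f i (x i) ^ 2} ≤
      ENNReal.ofReal (Real.exp (-b) * ∏ i, (√(1 - 2 * a i))⁻¹) := by
  have hint (i : ι) : Integrable (fun x => Real.exp (a i * f i x ^ 2)) (μ i) :=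
    ((hf i).integrable_comp (integrable_exp_mul_sq_gaussianReal (ha i)).aestronglyMeasurable).2
      (integrable_exp_mul_sq_gaussianReal (ha i))
  have hval (i : ι) : ∫ x, Real.exp (a i * f i x ^ 2) ∂(μ i) = (√(1 - 2 * a i))⁻¹ := by
    rw [← integral_exp_mul_sq_gaussianReal (ha i), ← (hf i).map_eq,
      integral_map (hf i).measurable.aemeasurable (by fun_prop)]
  have hprod := (Integrable.fintype_prod_dep (μ := μ) hint).const_mul (Real.exp (-b))
  simp only [← hval]
  rw [← integral_fintype_prod_eq_prod (μ := μ) (𝕜 := ℝ) fun i x => Real.exp (a i * f i x ^ 2),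
    ← integral_const_mul, ofReal_integral_eq_lintegral_ofReal hprod (ae_of_all _ fun x => by
      positivity)]
  refine meas_le_lintegral₀ hprod.aestronglyMeasurable.aemeasurable.ennreal_ofReal fun x hx => ?_
  rw [ENNReal.one_le_ofReal, ← Real.exp_sum, ← Real.exp_add, Real.one_le_exp_iff]
  linarith [show b ≤ ∑ i, a i * f i (x i) ^ 2 from hx]

variable {E : Type*} [NormedAddCommGroup E] [InnerProductSpace ℝ E] [FiniteDimensional ℝ E]
  [MeasurableSpace E] [BorelSpace E] {ι : Type*} [Fintype ι]

theorem stdGaussian_le_sum_mul_inner_sq_le (b : OrthonormalBasis ι ℝ E) {a : ι → ℝ}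
    (ha : ∀ i, a i < 1 / 2) :
    stdGaussian E {g | 0 ≤ ∑ i, a i * inner ℝ (b i) g ^ 2} ≤
      ENNReal.ofReal (∏ i, (√(1 - 2 * a i))⁻¹) := by
  classical
  rw [stdGaussian_eq_map_pi_orthonormalBasis b, Measure.map_apply (by fun_prop)
    (measurableSet_le (by fun_prop) (by fun_prop))]
  have h := measure_pi_le_sum_mul_sq_le (fun _ : ι => gaussianReal 0 1) (f := fun _ => id)
    (fun _ => MeasurePreserving.id _) ha 0
  rw [neg_zero, Real.exp_zero, one_mul] at h
  simpa only [preimage_ofPred_eq, id, b.orthonormal.inner_right_fintype] using h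

theorem stdGaussian_mul_norm_sq_le_sum_le (b : OrthonormalBasis ι ℝ E) {a : ι → ℝ}
    (ha : ∀ i, |a i| ≤ 1) (hsum : ∑ i, a i = 0) {ε : ℝ} (hε : 0 < ε) (hε1 : ε ≤ 1) :
    stdGaussian E {g | ε * ‖g‖ ^ 2 ≤ ∑ i, a i * inner ℝ (b i) g ^ 2} ≤
      ENNReal.ofReal (Real.exp (-(ε ^ 2 * Fintype.card ι / 64))) := by
  have hcoeff (i : ι) : |a i - ε| ≤ 2 := (abs_sub _ _).trans (by
    rw [abs_of_pos hε]
    linarith [ha i])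
  have hsmall (i : ι) : |ε / 32 * (a i - ε)| ≤ 1 / 4 := by
    rw [abs_mul, abs_of_pos (by positivity)]
    nlinarith [hcoeff i, abs_nonneg (a i - ε)]
  have hprod : ∏ i, (√(1 - 2 * (ε / 32 * (a i - ε))))⁻¹ ≤
      Real.exp (-(ε ^ 2 * Fintype.card ι / 64)) :=
    calc ∏ i, (√(1 - 2 * (ε / 32 * (a i - ε))))⁻¹
        ≤ ∏ i, Real.exp (ε / 32 * (a i - ε) + ε ^ 2 / 64) := by
          refine Finset.prod_le_prod (fun i _ => by positivity) fun i _ =>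
            (inv_sqrt_one_sub_le (hsmall i)).trans (Real.exp_le_exp.2 ?_)
          have := (sq_le_sq' (by linarith [(abs_le.1 (hcoeff i)).1]) (abs_le.1 (hcoeff i)).2)
          nlinarith [sq_nonneg ε]
      _ = Real.exp (-(ε ^ 2 * Fintype.card ι / 64)) := by
          rw [← Real.exp_sum, Finset.sum_add_distrib, ← Finset.mul_sum, Finset.sum_sub_distrib,
            hsum, Finset.sum_const, Finset.sum_const, Finset.card_univ, nsmul_eq_mul, nsmul_eq_mul]
          ring_nf
  refine (measure_mono fun g hg => ?_).trans ((stdGaussian_le_sum_mul_inner_sq_le b fun i =>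
    (abs_le.1 (hsmall i)).2.trans_lt (by norm_num)).trans (ENNReal.ofReal_le_ofReal hprod))
  have hexpand : ∑ i, ε / 32 * (a i - ε) * inner ℝ (b i) g ^ 2 =
      ε / 32 * (∑ i, a i * inner ℝ (b i) g ^ 2 - ε * ‖g‖ ^ 2) := by
    rw [← b.sum_sq_inner_right g, Finset.mul_sum _ _ ε, ← Finset.sum_sub_distrib, Finset.mul_sum]
    exact Finset.sum_congr rfl fun i _ => by ring
  rw [mem_ofPred_eq, hexpand]
  exact mul_nonneg (by positivity) (sub_nonneg.2 hg)

theorem stdGaussian_mul_norm_sq_le_abs_sum_le (b : OrthonormalBasis ι ℝ E) {a : ι → ℝ}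
    (ha : ∀ i, |a i| ≤ 1) (hsum : ∑ i, a i = 0) {ε : ℝ} (hε : 0 < ε) (hε1 : ε ≤ 1) :
    stdGaussian E {g | ε * ‖g‖ ^ 2 ≤ |∑ i, a i * inner ℝ (b i) g ^ 2|} ≤
      ENNReal.ofReal (2 * Real.exp (-(ε ^ 2 * Fintype.card ι / 64))) := by
  have hneg := stdGaussian_mul_norm_sq_le_sum_le b (a := -a) (by simpa using ha)
    (by simpa using hsum) hε hε1
  simp only [Pi.neg_apply, neg_mul, Finset.sum_neg_distrib] at hneg
  rw [two_mul, ENNReal.ofReal_add (Real.exp_pos _).le (Real.exp_pos _).le]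
  simp only [le_abs, ofPred_or]
  exact (measure_union_le _ _).trans
    (add_le_add (stdGaussian_mul_norm_sq_le_sum_le b ha hsum hε hε1) hneg)

end GaussianQuadraticForms

section ProjectionConcentration

variable {ι : Type*} [Fintype ι] {P : Matrix ι ι ℝ}

theorem dotProduct_mulVec_eq_sum_eigenvalues [DecidableEq ι] (hP : P.IsHermitian)
    (g : EuclideanSpace ℝ ι) :
    g.ofLp ⬝ᵥ (P *ᵥ g.ofLp) = ∑ i, hP.eigenvalues i * inner ℝ (hP.eigenvectorBasis i) g ^ 2 := by
  have hcoord (i : ι) : inner ℝ (hP.eigenvectorBasis i) (WithLp.toLp 2 (P *ᵥ g.ofLp)) =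
      hP.eigenvalues i * inner ℝ (hP.eigenvectorBasis i) g := by
    simp only [EuclideanSpace.inner_eq_star_dotProduct, star_trivial]
    rw [dotProduct_comm, dotProduct_comm g.ofLp, Matrix.dotProduct_mulVec,
      ← Matrix.mulVec_transpose, ← Matrix.conjTranspose_eq_transpose_of_trivial, hP.eq,
      hP.mulVec_eigenvectorBasis, smul_dotProduct, smul_eq_mul]
  calc g.ofLp ⬝ᵥ (P *ᵥ g.ofLp) = inner ℝ g (WithLp.toLp 2 (P *ᵥ g.ofLp)) := by
        rw [EuclideanSpace.inner_eq_star_dotProduct, star_trivial, dotProduct_comm]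
    _ = _ := by
        rw [← hP.eigenvectorBasis.sum_inner_mul_inner]
        refine Finset.sum_congr rfl fun i _ => ?_
        rw [hcoord, real_inner_comm]
        ring

theorem eigenvalues_mem_Icc_of_isStarProjection [DecidableEq ι] (hP : IsStarProjection P)
    (i : ι) :
    hP.isSelfAdjoint.isHermitian.eigenvalues i ∈ Icc 0 1 := by
  rcases hP.isIdempotentElem.spectrum_subset ℝ
    (hP.isSelfAdjoint.isHermitian.eigenvalues_mem_spectrum_real i) with h | h <;>
  · rw [h]
    norm_num

theorem stdGaussian_abs_sub_trace_div_card_le (hP : IsStarProjection P) {ε : ℝ} (hε : 0 < ε)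
    (hε1 : ε ≤ 1) :
    stdGaussian (EuclideanSpace ℝ ι) {g | ε * ‖g‖ ^ 2 ≤
        |g.ofLp ⬝ᵥ (P *ᵥ g.ofLp) - P.trace / Fintype.card ι * ‖g‖ ^ 2|} ≤
      ENNReal.ofReal (2 * Real.exp (-(ε ^ 2 * Fintype.card ι / 64))) := by
  classical
  have hH : P.IsHermitian := hP.isSelfAdjoint.isHermitian
  have hl (i : ι) : hH.eigenvalues i ∈ Icc 0 1 := eigenvalues_mem_Icc_of_isStarProjection hP i
  set q := P.trace / Fintype.card ι with hq
  have htr : P.trace = ∑ i, hH.eigenvalues i := by simpa using hH.trace_eq_sum_eigenvalues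
  have hsum : ∑ i, (hH.eigenvalues i - q) = 0 := by
    rw [Finset.sum_sub_distrib, ← htr, Finset.sum_const, Finset.card_univ, nsmul_eq_mul, hq]
    cases isEmpty_or_nonempty ι
    · simp [Matrix.trace]
    · field_simp
      ring
  have hqmem : q ∈ Icc (0 : ℝ) 1 := by
    refine ⟨div_nonneg ?_ (Nat.cast_nonneg _), div_le_one_of_le₀ ?_ (Nat.cast_nonneg _)⟩
    · exact htr ▸ Finset.sum_nonneg fun i _ => (hl i).1
    · exact htr.trans_le ((Finset.sum_le_sum fun i _ => (hl i).2).trans_eq (by simp))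
  have hexpand (g : EuclideanSpace ℝ ι) : g.ofLp ⬝ᵥ (P *ᵥ g.ofLp) - q * ‖g‖ ^ 2 =
      ∑ i, (hH.eigenvalues i - q) * inner ℝ (hH.eigenvectorBasis i) g ^ 2 := by
    simp only [sub_mul, Finset.sum_sub_distrib, ← Finset.mul_sum]
    rw [dotProduct_mulVec_eq_sum_eigenvalues hH, hH.eigenvectorBasis.sum_sq_inner_right]
  simp only [hexpand]
  refine stdGaussian_mul_norm_sq_le_abs_sum_le _ (fun i => ?_) hsum hε hε1
  exact (abs_sub_le_of_le_of_le (hl i).1 (hl i).2 hqmem.1 hqmem.2).trans_eq (sub_zero 1)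

end ProjectionConcentration

section FullRank

variable {E : Type*} [NormedAddCommGroup E] [InnerProductSpace ℝ E] [FiniteDimensional ℝ E]
  [MeasurableSpace E] [BorelSpace E]

theorem measurePreserving_inner_stdGaussian {v : E} (hv : ‖v‖ = 1) :
    MeasurePreserving (fun g => inner ℝ v g) (stdGaussian E) (gaussianReal 0 1) := by
  refine ⟨by fun_prop, ?_⟩
  change (stdGaussian E).map (innerSL ℝ v) = gaussianReal 0 1
  rw [IsGaussian.map_eq_gaussianReal, integral_strongDual_stdGaussian, variance_dual_stdGaussian,
    innerSL_apply_norm, hv, one_pow, Real.toNNReal_one]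

theorem stdGaussian_submodule_eq_zero {W : Submodule ℝ E} (hW : W ≠ ⊤) :
    stdGaussian E (W : Set E) = 0 := by
  obtain ⟨v, hv, hv0⟩ := Submodule.exists_mem_ne_zero_of_ne_bot
    (mt Submodule.orthogonal_eq_bot_iff.1 hW)
  have hnull : NullSingletonClass (gaussianReal 0 1) :=
    nullSingletonClass_gaussianReal one_ne_zero
  have hmp := measurePreserving_inner_stdGaussian (norm_smul_inv_norm (𝕜 := ℝ) hv0)
  refine measure_mono_null (fun g hg => ?_)
    ((hmp.measure_preimage (measurableSet_singleton 0).nullMeasurableSet).trans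
      (measure_singleton _))
  rw [mem_preimage, mem_singleton_iff, inner_smul_left, (W.mem_orthogonal' v).1 hv g hg, mul_zero]

theorem stdGaussian_ae_ne_zero [Nontrivial E] : ∀ᵐ g ∂(stdGaussian E), g ≠ 0 := by
  rw [ae_iff]
  simpa using stdGaussian_submodule_eq_zero (E := E) bot_ne_top

end FullRank

section LinearIndependence

variable {E : Type*} [NormedAddCommGroup E] [NormedSpace ℝ E] [FiniteDimensional ℝ E]
  [MeasurableSpace E] [BorelSpace E]

theorem pi_ae_linearIndependent (μ : Measure E) [SigmaFinite μ]
    (hμ : ∀ W : Submodule ℝ E, W ≠ ⊤ → μ (W : Set E) = 0) {k : ℕ} (hk : k ≤ Module.finrank ℝ E) :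
    ∀ᵐ x ∂(Measure.pi fun _ : Fin k => μ), LinearIndependent ℝ x := by
  induction k with
  | zero => exact ae_of_all _ fun x => linearIndependent_empty_type
  | succ k ih =>
    have hmp := (measurePreserving_piFinSuccAbove (fun _ : Fin (k + 1) => μ) 0).symm
    have hmeas : MeasurableSet {x : Fin (k + 1) → E | LinearIndependent ℝ x} :=
      isOpen_setOfPred_linearIndependent.measurableSet
    rw [← hmp.map_eq, ae_map_iff hmp.measurable.aemeasurable hmeas]
    have hmeas' : MeasurableSet {z : E × (Fin k → E) | LinearIndependent ℝ
        ((MeasurableEquiv.piFinSuccAbove (fun _ : Fin (k + 1) => E) 0).symm (z.1, z.2))} :=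
      hmp.measurable hmeas
    refine (Measure.ae_prod_iff_ae_ae hmeas').2 ((Measure.ae_ae_comm hmeas').2 ?_)
    filter_upwards [ih (Nat.le_of_succ_le hk)] with z hz
    have hspan : Submodule.span ℝ (Set.range z) ≠ ⊤ := fun h => by
      have hcard := finrank_span_eq_card hz
      rw [h, finrank_top, Fintype.card_fin] at hcard
      lia
    have hnotMem : ∀ᵐ v ∂μ, v ∉ Submodule.span ℝ (Set.range z) := by
      rw [ae_iff]
      simpa using hμ _ hspan
    filter_upwards [hnotMem] with v hv
    have hcons : (MeasurableEquiv.piFinSuccAbove (fun _ : Fin (k + 1) => E) 0).symm (v, z) =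
        Fin.cons v z := by
      simp [MeasurableEquiv.piFinSuccAbove_symm_apply, Fin.insertNthEquiv]
    exact hcons ▸ linearIndependent_finCons.2 ⟨hz, hv⟩

end LinearIndependence

section GaussianSample

/-- The law of an i.i.d. sample of size `n` from `N(0, I)` on `ℝᵖ`. -/
noncomputable def gaussSample (n p : ℕ) : Measure (Fin n → EuclideanSpace ℝ (Fin p)) :=
  Measure.pi fun _ => stdGaussian (EuclideanSpace ℝ (Fin p))

instance isProbabilityMeasure_gaussSample (n p : ℕ) : IsProbabilityMeasure (gaussSample n p) :=
  inferInstanceAs (IsProbabilityMeasure (Measure.pi _))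

variable {m n p : ℕ}

section

variable {Ω : Type*} [MeasurableSpace Ω] {μ : Measure Ω} {X : Fin n → Ω → EuclideanSpace ℝ (Fin p)}

theorem IsGaussianSample.aemeasurable (h : IsGaussianSample μ X) :
    AEMeasurable (fun ω i => X i ω) μ :=
  aemeasurable_pi_lambda _ fun i => (h.law i).aemeasurable

theorem IsGaussianSample.map_eq [IsProbabilityMeasure μ] (h : IsGaussianSample μ X) :
    μ.map (fun ω i => X i ω) = gaussSample n p := by
  rw [(iIndepFun_iff_map_fun_eq_pi_map fun i => (h.law i).aemeasurable).1 h.indep, gaussSample]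
  simp only [(h.law _).map_eq]

theorem IsGaussianSample.precomp (h : IsGaussianSample μ X) {f : Fin m → Fin n}
    (hf : Function.Injective f) : IsGaussianSample μ fun i => X (f i) :=
  ⟨fun i => h.law (f i), h.indep.precomp hf⟩

end

theorem isGaussianSample_eval : IsGaussianSample (gaussSample n p) fun i x => x i where
  law i := ⟨(measurable_pi_apply i).aemeasurable,
    (measurePreserving_eval (fun _ : Fin n => stdGaussian (EuclideanSpace ℝ (Fin p))) i).map_eq⟩
  indep := iIndepFun_pi (X := fun _ x => x) fun _ => aemeasurable_id

theorem ae_injective_mulVec_dataMatrix (hpn : p ≤ n) :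
    ∀ᵐ x ∂(gaussSample n p), Function.Injective (dataMatrix x).mulVec := by
  have hsub := isGaussianSample_eval.precomp (p := p) (Fin.castLE_injective hpn)
  have hindep : ∀ᵐ x ∂(gaussSample p p), LinearIndependent ℝ x :=
    pi_ae_linearIndependent _ (fun _ => stdGaussian_submodule_eq_zero) (by simp)
  rw [← hsub.map_eq] at hindep
  filter_upwards [ae_of_ae_map hsub.aemeasurable hindep] with x hx
  have hrows : LinearIndependent ℝ ((dataMatrix x).submatrix (Fin.castLE hpn) id).row :=
    hx.map' _ (WithLp.linearEquiv 2 ℝ (Fin p → ℝ)).ker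
  have hinj := Matrix.mulVec_injective_of_isUnit (Matrix.linearIndependent_rows_iff_isUnit.1 hrows)
  exact fun v w hvw => hinj (funext fun i => congrFun hvw (Fin.castLE hpn i))

/-- The sample with data matrix `O * X`, where `X` is the data matrix of the sample `x`. -/
def mixSample (O : Matrix (Fin n) (Fin n) ℝ) (x : Fin n → EuclideanSpace ℝ (Fin p)) :
    Fin n → EuclideanSpace ℝ (Fin p) := fun i => ∑ j, O i j • x j

@[fun_prop]
theorem continuous_mixSample (O : Matrix (Fin n) (Fin n) ℝ) :
    Continuous (mixSample (p := p) O) := by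
  unfold mixSample
  fun_prop

theorem dataMatrix_mixSample (O : Matrix (Fin n) (Fin n) ℝ)
    (x : Fin n → EuclideanSpace ℝ (Fin p)) : dataMatrix (mixSample O x) = O * dataMatrix x := by
  ext i k
  simp [dataMatrix, mixSample, Matrix.mul_apply]

theorem inner_toLp_mixSample (O : Matrix (Fin n) (Fin n) ℝ)
    (x t : Fin n → EuclideanSpace ℝ (Fin p)) :
    inner ℝ (WithLp.toLp 2 (mixSample O x)) (WithLp.toLp 2 t) =
      inner ℝ (WithLp.toLp 2 x) (WithLp.toLp 2 (mixSample Oᵀ t)) := by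
  simp only [PiLp.inner_apply, mixSample, sum_inner, inner_sum, inner_smul_left, inner_smul_right,
    Matrix.transpose_apply, conj_trivial]
  exact Finset.sum_comm

theorem norm_toLp_mixSample {O : Matrix (Fin n) (Fin n) ℝ}
    (hO : O ∈ Matrix.orthogonalGroup (Fin n) ℝ) (x : Fin n → EuclideanSpace ℝ (Fin p)) :
    ‖WithLp.toLp 2 (mixSample O x)‖ = ‖WithLp.toLp 2 x‖ := by
  have hinv : mixSample Oᵀ (mixSample O x) = x := by
    have h : dataMatrix (mixSample Oᵀ (mixSample O x)) = dataMatrix x := by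
      rw [dataMatrix_mixSample, dataMatrix_mixSample, ← Matrix.mul_assoc]
      exact (congrArg (· * dataMatrix x) ((Matrix.mem_orthogonalGroup_iff' _ _).1 hO)).trans
        (Matrix.one_mul _)
    exact funext fun i => WithLp.ofLp_injective 2 (congrFun h i)
  rw [← sq_eq_sq₀ (norm_nonneg _) (norm_nonneg _), ← real_inner_self_eq_norm_sq,
    ← real_inner_self_eq_norm_sq, inner_toLp_mixSample, hinv]

theorem charFun_map_toLp_gaussSample
    (t : PiLp 2 fun _ : Fin n => EuclideanSpace ℝ (Fin p)) :
    charFun ((gaussSample n p).map (WithLp.toLp 2)) t = Complex.exp (-‖t‖ ^ 2 / 2) := by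
  rw [gaussSample, charFun_pi]
  simp only [charFun_stdGaussian, ← Complex.exp_sum, ← Finset.sum_div, Finset.sum_neg_distrib]
  rw [← Complex.ofReal_pow, PiLp.norm_sq_eq_of_L2]
  push_cast
  rfl

theorem measurePreserving_mixSample {O : Matrix (Fin n) (Fin n) ℝ}
    (hO : O ∈ Matrix.orthogonalGroup (Fin n) ℝ) :
    MeasurePreserving (mixSample (p := p) O) (gaussSample n p) (gaussSample n p) := by
  have hmeas : Measurable (mixSample (p := p) O) := (continuous_mixSample O).measurable
  refine ⟨hmeas, ?_⟩
  have : IsFiniteMeasure ((gaussSample n p).map (mixSample O)) := Measure.isFiniteMeasure_map _ _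
  conv_rhs => rw [gaussSample]
  rw [← charFun_eq_pi_iff]
  intro t
  have hOt : Oᵀ ∈ Matrix.orthogonalGroup (Fin n) ℝ :=
    (Matrix.mem_orthogonalGroup_iff' _ _).2 ((Matrix.mem_orthogonalGroup_iff _ _).1 hO)
  have hadjoint : charFun (((gaussSample n p).map (mixSample O)).map (WithLp.toLp 2)) t =
      charFun ((gaussSample n p).map (WithLp.toLp 2)) (WithLp.toLp 2 (mixSample Oᵀ t.ofLp)) := by
    rw [charFun_apply, charFun_apply, integral_map (by fun_prop) (by fun_prop),
      integral_map (by fun_prop) (by fun_prop), integral_map (by fun_prop) (by fun_prop)]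
    simp only [← inner_toLp_mixSample, WithLp.toLp_ofLp]
  rw [hadjoint, charFun_map_toLp_gaussSample, norm_toLp_mixSample hOt,
    WithLp.toLp_ofLp, ← charFun_map_toLp_gaussSample, gaussSample, charFun_pi]

end GaussianSample

section OrthogonalInvariance

variable {n p : ℕ}

theorem exists_mem_orthogonalGroup_mulVec_eq {ι : Type*} [Fintype ι] [DecidableEq ι]
    {a b : EuclideanSpace ℝ ι} (hab : ‖a‖ = ‖b‖) :
    ∃ O ∈ Matrix.orthogonalGroup ι ℝ, O *ᵥ a.ofLp = b.ofLp ∧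
      ∀ v : EuclideanSpace ℝ ι, inner ℝ a v = 0 → inner ℝ b v = 0 → O *ᵥ v.ofLp = v.ofLp := by
  set R := (Submodule.span ℝ {a - b})ᗮ.reflection
  set T : EuclideanSpace ℝ ι →L[ℝ] EuclideanSpace ℝ ι :=
    R.toContinuousLinearEquiv.toContinuousLinearMap
  set O : Matrix ι ι ℝ := (Matrix.toEuclideanCLM (n := ι) (𝕜 := ℝ)).symm T with hO
  have hact (v : EuclideanSpace ℝ ι) : O *ᵥ v.ofLp = (R v).ofLp := by
    rw [← Matrix.ofLp_toEuclideanCLM, hO, StarAlgEquiv.apply_symm_apply]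
    rfl
  have hisometry : star T * T = 1 :=
    (ContinuousLinearMap.norm_map_iff_adjoint_comp_self T).1 R.norm_map
  refine ⟨O, (Matrix.mem_orthogonalGroup_iff' _ _).2 ?_, ?_, fun v hav hbv => ?_⟩
  · have hstar : Oᵀ = (Matrix.toEuclideanCLM (n := ι) (𝕜 := ℝ)).symm (star T) :=
      (map_star (Matrix.toEuclideanCLM (n := ι) (𝕜 := ℝ)).symm T).symm
    rw [hstar, hO, ← map_mul, hisometry, map_one]
  · rw [hact, Submodule.reflection_sub hab]
  · rw [hact, Submodule.reflection_mem_subspace_eq_self]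
    rw [Submodule.mem_orthogonal_singleton_iff_inner_right, inner_sub_left, hav, hbv, sub_zero]

theorem hatMatrix_mixSample {O : Matrix (Fin n) (Fin n) ℝ}
    (hO : O ∈ Matrix.orthogonalGroup (Fin n) ℝ) (x : Fin n → EuclideanSpace ℝ (Fin p)) :
    hatMatrix (dataMatrix (mixSample O x)) = O * hatMatrix (dataMatrix x) * Oᵀ := by
  have hgram : (O * dataMatrix x)ᵀ * (O * dataMatrix x) = (dataMatrix x)ᵀ * dataMatrix x := by
    rw [Matrix.transpose_mul, Matrix.mul_assoc, ← Matrix.mul_assoc Oᵀ,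
      (Matrix.mem_orthogonalGroup_iff' _ _).1 hO, Matrix.one_mul]
  rw [dataMatrix_mixSample, hatMatrix, hgram, hatMatrix, Matrix.transpose_mul]
  simp only [Matrix.mul_assoc]

theorem dotProduct_hatMatrix_mixSample {O : Matrix (Fin n) (Fin n) ℝ}
    (hO : O ∈ Matrix.orthogonalGroup (Fin n) ℝ) (x : Fin n → EuclideanSpace ℝ (Fin p))
    (v w : Fin n → ℝ) :
    (O *ᵥ v) ⬝ᵥ (hatMatrix (dataMatrix (mixSample O x)) *ᵥ (O *ᵥ w)) =
      v ⬝ᵥ (hatMatrix (dataMatrix x) *ᵥ w) := by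
  have hO' := (Matrix.mem_orthogonalGroup_iff' _ _).1 hO
  rw [hatMatrix_mixSample hO, Matrix.mulVec_mulVec, Matrix.mul_assoc, hO', Matrix.mul_one,
    ← Matrix.mulVec_mulVec, Matrix.dotProduct_mulVec, ← Matrix.mulVec_transpose,
    Matrix.mulVec_mulVec, hO', Matrix.one_mulVec]

theorem measurable_hatMatrix_apply (i j : Fin n) :
    Measurable fun x : Fin n → EuclideanSpace ℝ (Fin p) => hatMatrix (dataMatrix x) i j := by
  have hX : Continuous (dataMatrix : (Fin n → EuclideanSpace ℝ (Fin p)) → _) :=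
    continuous_matrix fun i k => by
      simp only [dataMatrix, Matrix.of_apply]
      fun_prop
  have hgram := hX.matrix_transpose.matrix_mul hX
  have hnum := (hX.matrix_mul hgram.matrix_adjugate).matrix_mul hX.matrix_transpose
  simp only [hatMatrix, Matrix.inv_def, Matrix.mul_smul, Matrix.smul_mul, Matrix.smul_apply,
    Ring.inverse_eq_inv', smul_eq_mul]
  exact hgram.matrix_det.measurable.inv.mul (hnum.matrix_elem i j).measurable

end OrthogonalInvariance

section LeverageConcentration

variable {n p : ℕ}

theorem le_of_ae_measure_slices {α β : Type*} [MeasurableSpace α] [MeasurableSpace β]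
    {μ : Measure α} {ν : Measure β} [IsProbabilityMeasure μ] [IsProbabilityMeasure ν]
    {S : Set (α × β)} (hS : MeasurableSet S) {c C : ENNReal}
    (hc : ∀ᵐ b ∂ν, c ≤ μ ((fun a => (a, b)) ⁻¹' S)) (hC : ∀ᵐ a ∂μ, ν (Prod.mk a ⁻¹' S) ≤ C) :
    c ≤ C :=
  calc c = ∫⁻ _, c ∂ν := by simp
    _ ≤ ∫⁻ b, μ ((fun a => (a, b)) ⁻¹' S) ∂ν := lintegral_mono_ae hc
    _ = ∫⁻ a, ν (Prod.mk a ⁻¹' S) ∂μ := by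
        rw [← Measure.prod_apply_symm hS, Measure.prod_apply hS]
    _ ≤ ∫⁻ _, C ∂μ := lintegral_mono_ae hC
    _ = C := by simp

theorem gaussSample_quadraticForm_eq_leverage {g : EuclideanSpace ℝ (Fin n)} (hg : g ≠ 0)
    (ε q : ℝ) (i : Fin n) :
    gaussSample n p {x | ε * ‖g‖ ^ 2 ≤
        |g.ofLp ⬝ᵥ (hatMatrix (dataMatrix x) *ᵥ g.ofLp) - q * ‖g‖ ^ 2|} =
      gaussSample n p {x | ε ≤ |hatMatrix (dataMatrix x) i i - q|} := by
  obtain ⟨O, hO, hOg, -⟩ := exists_mem_orthogonalGroup_mulVec_eq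
    (a := g) (b := EuclideanSpace.single i ‖g‖) (by simp)
  have hmeas : MeasurableSet {x : Fin n → EuclideanSpace ℝ (Fin p) |
      ε ≤ |hatMatrix (dataMatrix x) i i - q|} :=
    measurableSet_le measurable_const ((measurable_hatMatrix_apply i i).sub_const q).abs
  rw [← (measurePreserving_mixSample hO).measure_preimage hmeas.nullMeasurableSet]
  congr 1
  ext x
  have hquad : g.ofLp ⬝ᵥ (hatMatrix (dataMatrix x) *ᵥ g.ofLp) =
      hatMatrix (dataMatrix (mixSample O x)) i i * ‖g‖ ^ 2 := by
    rw [← dotProduct_hatMatrix_mixSample hO, hOg, PiLp.ofLp_single, Matrix.mulVec_single,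
      single_dotProduct]
    simp only [Pi.smul_apply, MulOpposite.smul_eq_mul_unop, MulOpposite.unop_op, Matrix.col_apply]
    ring
  have hpos : 0 < ‖g‖ ^ 2 := by positivity
  simp only [mem_preimage, mem_ofPred_eq]
  rw [hquad, ← sub_mul, abs_mul, abs_of_pos hpos]
  exact mul_le_mul_iff_left₀ hpos

theorem gaussSample_abs_leverage_sub_le (hpn : p ≤ n) {ε : ℝ} (hε : 0 < ε) (hε1 : ε ≤ 1)
    (i : Fin n) :
    gaussSample n p {x | ε ≤ |hatMatrix (dataMatrix x) i i - (p : ℝ) / n|} ≤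
      ENNReal.ofReal (2 * Real.exp (-(ε ^ 2 * n / 64))) := by
  set S : Set ((Fin n → EuclideanSpace ℝ (Fin p)) × EuclideanSpace ℝ (Fin n)) :=
    {z | ε * ‖z.2‖ ^ 2 ≤
      |z.2.ofLp ⬝ᵥ (hatMatrix (dataMatrix z.1) *ᵥ z.2.ofLp) - (p : ℝ) / n * ‖z.2‖ ^ 2|}
  have hmeas : MeasurableSet S := by
    have hcoord (j : Fin n) : Measurable fun z : (Fin n → EuclideanSpace ℝ (Fin p)) ×
      EuclideanSpace ℝ (Fin n) => z.2.ofLp j := by fun_prop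
    refine measurableSet_le (by fun_prop) (Measurable.sub ?_ (by fun_prop)).abs
    simp only [dotProduct, Matrix.mulVec]
    refine Finset.measurable_sum _ fun j _ => (hcoord j).mul (Finset.measurable_sum _ fun k _ => ?_)
    exact ((measurable_hatMatrix_apply j k).comp measurable_fst).mul (hcoord k)
  have : Nonempty (Fin n) := ⟨i⟩
  refine le_of_ae_measure_slices (μ := gaussSample n p)
    (ν := stdGaussian (EuclideanSpace ℝ (Fin n))) hmeas ?_ ?_
  · filter_upwards [stdGaussian_ae_ne_zero] with g hg
    exact (gaussSample_quadraticForm_eq_leverage hg ε _ i).ge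
  · filter_upwards [ae_injective_mulVec_dataMatrix hpn] with x hx
    have h := stdGaussian_abs_sub_trace_div_card_le (isStarProjection_hatMatrix hx) hε hε1
    rwa [trace_hatMatrix hx, Fintype.card_fin, Fintype.card_fin] at h

end LeverageConcentration

section RadialMeasures

variable {E : Type*} [NormedAddCommGroup E] [InnerProductSpace ℝ E] [MeasurableSpace E]

/-- A measure is radial if its characteristic function depends only on the norm, which for finite
measures on a finite-dimensional space means invariance under all linear isometries. -/
def IsRadial (ν : Measure E) : Prop :=
  ∀ θ θ' : E, ‖θ‖ = ‖θ'‖ → charFun ν θ = charFun ν θ'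

variable [BorelSpace E] {ν ν' : Measure E}

theorem isRadial_stdGaussian [FiniteDimensional ℝ E] : IsRadial (stdGaussian E) := fun θ θ' h => by
  rw [charFun_stdGaussian, charFun_stdGaussian, h]

variable [SecondCountableTopology E] [IsProbabilityMeasure ν] [IsProbabilityMeasure ν']

theorem IsRadial.charFun_map_prod (h : IsRadial ν) (θ : E) :
    charFun ((ν.prod ν').map fun z => ‖z.2‖ • z.1) θ =
      ∫ z, Complex.exp ((‖θ‖ * inner ℝ z.1 z.2 : ℝ) * Complex.I) ∂(ν.prod ν') := by
  have hint {f : E × E → ℝ} (hf : Continuous f) :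
      Integrable (fun z => Complex.exp (f z * Complex.I)) (ν.prod ν') :=
    Integrable.of_bound (C := 1) (by fun_prop)
      (ae_of_all _ fun z => (Complex.norm_exp_ofReal_mul_I _).le)
  rw [charFun_apply, integral_map (by fun_prop) (by fun_prop),
    integral_prod_symm _ (hint (f := fun z => inner ℝ (‖z.2‖ • z.1) θ) (by fun_prop)),
    integral_prod_symm _ (hint (f := fun z => ‖θ‖ * inner ℝ z.1 z.2) (by fun_prop))]
  congr 1
  funext w
  have hswap := h (‖w‖ • θ) (‖θ‖ • w) (by simp only [norm_smul, norm_norm, mul_comm])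
  simpa only [charFun_apply, real_inner_smul_left, real_inner_smul_right] using hswap

theorem IsRadial.map_prod_eq [CompleteSpace E] (h : IsRadial ν) (h' : IsRadial ν') :
    (ν.prod ν').map (fun z => ‖z.2‖ • z.1) = (ν.prod ν').map (fun z => ‖z.1‖ • z.2) := by
  have hswap : (ν.prod ν').map (fun z => ‖z.1‖ • z.2) =
      (ν'.prod ν).map (fun z => ‖z.2‖ • z.1) := by
    rw [← Measure.prod_swap, Measure.map_map (by fun_prop) measurable_swap]
    rfl
  have : IsProbabilityMeasure ((ν.prod ν').map fun z => ‖z.2‖ • z.1) :=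
    Measure.isProbabilityMeasure_map (by fun_prop)
  have : IsProbabilityMeasure ((ν'.prod ν).map fun z => ‖z.2‖ • z.1) :=
    Measure.isProbabilityMeasure_map (by fun_prop)
  rw [hswap]
  refine Measure.ext_of_charFun (funext fun θ => ?_)
  rw [h.charFun_map_prod, h'.charFun_map_prod, ← Measure.prod_swap,
    integral_map measurable_swap.aemeasurable (by fun_prop)]
  simp only [Prod.fst_swap, Prod.snd_swap, real_inner_comm]

theorem IsRadial.measure_cone_le [CompleteSpace E] (h : IsRadial ν) (h' : IsRadial ν')
    (hν' : ∀ᵐ w ∂ν', w ≠ 0) {D : Set E} (hD : MeasurableSet D)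
    (hsmul : ∀ c : ℝ, 0 < c → ∀ v, c • v ∈ D ↔ v ∈ D) (h0 : (0 : E) ∉ D) : ν D ≤ ν' D :=
  calc ν D = (ν.prod ν') (Prod.fst ⁻¹' D) :=
        (measurePreserving_fst.measure_preimage hD.nullMeasurableSet).symm
    _ ≤ (ν.prod ν') ((fun z => ‖z.2‖ • z.1) ⁻¹' D) := by
        refine measure_mono_ae ?_
        filter_upwards [Measure.quasiMeasurePreserving_snd.ae hν'] with z hz hzD
        exact (hsmul _ (norm_pos_iff.2 hz) _).2 hzD
    _ = (ν.prod ν') ((fun z => ‖z.1‖ • z.2) ⁻¹' D) := by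
        rw [← Measure.map_apply (by fun_prop) hD, ← Measure.map_apply (by fun_prop) hD,
          h.map_prod_eq h']
    _ ≤ (ν.prod ν') (Prod.snd ⁻¹' D) := by
        refine measure_mono fun z hz => ?_
        have hz1 : z.1 ≠ 0 := fun h1 => h0 (by simpa [h1] using hz)
        exact (hsmul _ (norm_pos_iff.2 hz1) _).1 hz
    _ = ν' D := measurePreserving_snd.measure_preimage hD.nullMeasurableSet

end RadialMeasures

section RowSpread

theorem prod_inv_sqrt_le {κ : Type*} [Fintype κ] [DecidableEq κ] {J : Finset κ}
    (hJ : Fintype.card κ ≤ 4 * J.card) :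
    ∏ j, (√(1 - 2 * if j ∈ J then 1 / 4 - 2 ^ 31 else 1 / 4 : ℝ))⁻¹ ≤
      (1 / 8) ^ Fintype.card κ :=
  calc _ ≤ ∏ j, (2 * if j ∈ J then (1 / 2 ^ 16 : ℝ) else 1) := by
        refine Finset.prod_le_prod (fun j _ => by positivity) fun j _ => ?_
        split_ifs <;>
          refine inv_le_of_inv_le₀ (by positivity) (Real.le_sqrt_of_sq_le ?_) <;> norm_num
    _ = 2 ^ Fintype.card κ * (1 / 2 ^ 4) ^ (4 * J.card) := by
        rw [Finset.prod_mul_distrib, Finset.prod_ite_mem, Finset.univ_inter, Finset.prod_const,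
          Finset.prod_const, Finset.card_univ, pow_mul]
        norm_num
    _ ≤ 2 ^ Fintype.card κ * (1 / 2 ^ 4) ^ Fintype.card κ :=
        mul_le_mul_of_nonneg_left (pow_le_pow_of_le_one (by norm_num) (by norm_num) hJ)
          (by positivity)
    _ = (1 / 8) ^ Fintype.card κ := by
        rw [← mul_pow]
        norm_num

theorem stdGaussian_sum_sq_lt_le {κ : Type*} [Fintype κ] {J : Finset κ}
    (hJ : Fintype.card κ ≤ 4 * J.card) :
    stdGaussian (EuclideanSpace ℝ κ) {g | ∑ j ∈ J, g j ^ 2 < 1 / 2 ^ 33 * ‖g‖ ^ 2} ≤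
      ENNReal.ofReal ((1 / 8) ^ Fintype.card κ) := by
  classical
  set a : κ → ℝ := fun j => if j ∈ J then 1 / 4 - 2 ^ 31 else 1 / 4 with ha
  have hlt (j : κ) : a j < 1 / 2 := by
    simp only [ha]
    split_ifs <;> norm_num
  refine (measure_mono fun g hg => ?_).trans
    ((stdGaussian_le_sum_mul_inner_sq_le (EuclideanSpace.basisFun κ ℝ) hlt).trans
      (ENNReal.ofReal_le_ofReal (prod_inv_sqrt_le hJ)))
  have hsum : ∑ j, a j * g j ^ 2 = 1 / 4 * ‖g‖ ^ 2 - 2 ^ 31 * ∑ j ∈ J, g j ^ 2 := by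
    have hterm (j : κ) :
        a j * g j ^ 2 = 1 / 4 * g j ^ 2 - if j ∈ J then 2 ^ 31 * g j ^ 2 else 0 := by
      simp only [ha]
      split_ifs <;> ring
    simp only [hterm]
    rw [Finset.sum_sub_distrib, Finset.sum_ite_mem, Finset.univ_inter, ← Finset.mul_sum,
      ← Finset.mul_sum, EuclideanSpace.real_norm_sq_eq]
  simp only [mem_ofPred_eq, EuclideanSpace.basisFun_inner] at hg ⊢
  rw [hsum]
  linarith

theorem IsRadial.sum_sq_lt_le {κ : Type*} [Fintype κ] [Nonempty κ]
    {ν : Measure (EuclideanSpace ℝ κ)} [IsProbabilityMeasure ν] (hν : IsRadial ν) {J : Finset κ}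
    (hJ : Fintype.card κ ≤ 4 * J.card) :
    ν {v | ∑ j ∈ J, v j ^ 2 < 1 / 2 ^ 33 * ‖v‖ ^ 2} ≤
      ENNReal.ofReal ((1 / 8) ^ Fintype.card κ) := by
  refine (hν.measure_cone_le isRadial_stdGaussian stdGaussian_ae_ne_zero
    (measurableSet_lt (by fun_prop) (by fun_prop)) (fun c hc v => ?_) (by simp)).trans
    (stdGaussian_sum_sq_lt_le hJ)
  simp only [mem_ofPred_eq, PiLp.smul_apply, smul_eq_mul, mul_pow, norm_smul, ← Finset.mul_sum,
    Real.norm_eq_abs, sq_abs]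
  rw [mul_left_comm]
  exact mul_lt_mul_iff_right₀ (by positivity)

variable {n p : ℕ}

/-- The off-diagonal part of the `i`-th row of the hat matrix of a sample. -/
noncomputable def hatRow (i : Fin n) (x : Fin n → EuclideanSpace ℝ (Fin p)) :
    EuclideanSpace ℝ {j // j ≠ i} := WithLp.toLp 2 fun j => hatMatrix (dataMatrix x) i j

@[fun_prop]
theorem measurable_hatRow (i : Fin n) : Measurable (hatRow (p := p) i) :=
  (WithLp.measurable_toLp 2 _).comp
    (measurable_pi_lambda _ fun j => measurable_hatMatrix_apply i j)

theorem norm_sq_hatRow {x : Fin n → EuclideanSpace ℝ (Fin p)}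
    (hx : Function.Injective (dataMatrix x).mulVec) (i : Fin n) :
    ‖hatRow i x‖ ^ 2 =
      hatMatrix (dataMatrix x) i i * (1 - hatMatrix (dataMatrix x) i i) := by
  have h := sum_hatMatrix_sq hx i
  rw [Fintype.sum_eq_add_sum_subtype_ne _ i] at h
  rw [EuclideanSpace.real_norm_sq_eq]
  simp only [hatRow]
  linarith

/-- Extension of a vector by a zero entry at `i`. -/
noncomputable def extendZero {i : Fin n} (θ : EuclideanSpace ℝ {j // j ≠ i}) :
    EuclideanSpace ℝ (Fin n) := WithLp.toLp 2 (Function.extend Subtype.val θ.ofLp 0)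

theorem extendZero_apply {i : Fin n} (θ : EuclideanSpace ℝ {j // j ≠ i}) (j : {j // j ≠ i}) :
    extendZero θ j = θ j :=
  Subtype.val_injective.extend_apply _ _ _

theorem extendZero_self {i : Fin n} (θ : EuclideanSpace ℝ {j // j ≠ i}) : extendZero θ i = 0 :=
  Function.extend_apply' _ _ _ fun ⟨j, hj⟩ => j.2 hj

theorem norm_extendZero {i : Fin n} (θ : EuclideanSpace ℝ {j // j ≠ i}) :
    ‖extendZero θ‖ = ‖θ‖ := by
  rw [EuclideanSpace.norm_eq, EuclideanSpace.norm_eq, Fintype.sum_eq_add_sum_subtype_ne _ i]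
  simp only [extendZero_apply, extendZero_self, norm_zero]
  rw [zero_pow two_ne_zero, zero_add]

theorem inner_hatRow (i : Fin n) (x : Fin n → EuclideanSpace ℝ (Fin p))
    (θ : EuclideanSpace ℝ {j // j ≠ i}) :
    inner ℝ (hatRow i x) θ =
      Pi.single i 1 ⬝ᵥ (hatMatrix (dataMatrix x) *ᵥ (extendZero θ).ofLp) := by
  rw [single_dotProduct, one_mul, Matrix.mulVec, dotProduct,
    Fintype.sum_eq_add_sum_subtype_ne _ i]
  simp only [extendZero_apply, extendZero_self, mul_zero, zero_add]
  simp only [PiLp.inner_apply, hatRow, RCLike.inner_apply, conj_trivial, mul_comm]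

theorem isRadial_hatRow (i : Fin n) : IsRadial ((gaussSample n p).map (hatRow i)) := by
  intro θ θ' hθ
  obtain ⟨O, hO, hOθ, hfix⟩ := exists_mem_orthogonalGroup_mulVec_eq
    (a := extendZero θ) (b := extendZero θ') (by rw [norm_extendZero, norm_extendZero, hθ])
  have horth (θ : EuclideanSpace ℝ {j // j ≠ i}) :
      inner ℝ (extendZero θ) (EuclideanSpace.single i (1 : ℝ)) = 0 := by
    rw [EuclideanSpace.inner_single_right, extendZero_self, map_zero, mul_zero]
  have hOi : O *ᵥ Pi.single i 1 = Pi.single i 1 :=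
    hfix (EuclideanSpace.single i 1) (horth θ) (horth θ')
  have hinner (x : Fin n → EuclideanSpace ℝ (Fin p)) :
      inner ℝ (hatRow i (mixSample O x)) θ' = inner ℝ (hatRow i x) θ := by
    rw [inner_hatRow, inner_hatRow, ← dotProduct_hatMatrix_mixSample hO x, hOi, hOθ]
  have hmp := measurePreserving_mixSample (p := p) hO
  conv_rhs => rw [← hmp.map_eq]
  rw [charFun_apply, charFun_apply, integral_map (by fun_prop) (by fun_prop),
    integral_map (by fun_prop) (by fun_prop), integral_map hmp.measurable.aemeasurable
      (Measurable.aestronglyMeasurable (by fun_prop))]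
  simp only [hinner]

theorem gaussSample_hatRow_sum_sq_lt_le (hn : 2 ≤ n) :
    gaussSample n p {x | ∃ (i : Fin n) (J : Finset {j // j ≠ i}), n ≤ 4 * J.card + 1 ∧
        ∑ j ∈ J, hatRow i x j ^ 2 < 1 / 2 ^ 33 * ‖hatRow i x‖ ^ 2} ≤
      ENNReal.ofReal (4 * n * (1 / 4) ^ n) := by
  have hcard (i : Fin n) : Fintype.card {j // j ≠ i} = n - 1 := by
    rw [Fintype.card_subtype_compl, Fintype.card_fin, Fintype.card_subtype_eq]
  have hbound (i : Fin n) (J : Finset {j // j ≠ i}) :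
      gaussSample n p {x | n ≤ 4 * J.card + 1 ∧
        ∑ j ∈ J, hatRow i x j ^ 2 < 1 / 2 ^ 33 * ‖hatRow i x‖ ^ 2} ≤
        ENNReal.ofReal ((1 / 8) ^ (n - 1)) := by
    by_cases hJ : n ≤ 4 * J.card + 1
    · have : Nonempty {j // j ≠ i} := Fintype.card_pos_iff.1 (by rw [hcard]; lia)
      have : IsProbabilityMeasure ((gaussSample n p).map (hatRow i)) :=
        Measure.isProbabilityMeasure_map (by fun_prop)
      have h := (isRadial_hatRow (p := p) i).sum_sq_lt_le (J := J) (by rw [hcard]; lia)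
      rw [Measure.map_apply (by fun_prop) (measurableSet_lt (by fun_prop) (by fun_prop)),
        hcard] at h
      simpa only [hJ, true_and, preimage_ofPred_eq] using h
    · simp [hJ]
  simp only [ofPred_exists]
  calc _ ≤ ∑ i : Fin n, ∑ _J : Finset {j // j ≠ i}, ENNReal.ofReal ((1 / 8) ^ (n - 1)) :=
        (measure_iUnion_fintype_le _ _).trans (Finset.sum_le_sum fun i _ =>
          (measure_iUnion_fintype_le _ _).trans (Finset.sum_le_sum fun J _ => hbound i J))
    _ = ENNReal.ofReal (4 * n * (1 / 4) ^ n) := by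
        simp only [Finset.sum_const, Finset.card_univ, Fintype.card_finset, hcard,
          Fintype.card_fin]
        rw [← ENNReal.ofReal_nsmul, ← ENNReal.ofReal_nsmul, nsmul_eq_mul, nsmul_eq_mul,
          Nat.cast_pow, ← mul_pow]
        obtain ⟨m, rfl⟩ : ∃ m, n = m + 1 := ⟨n - 1, by lia⟩
        rw [Nat.add_sub_cancel, pow_succ (1 / 4 : ℝ)]
        congr 1
        norm_num
        ring

end RowSpread

section OperatorNorm

variable {E : Type*} [NormedAddCommGroup E] [NormedSpace ℝ E] [FiniteDimensional ℝ E]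
  [MeasurableSpace E] [BorelSpace E]

theorem measure_ball_le_two_mul_of_convexOn {f : E → ℝ} (hf : ConvexOn ℝ univ f) (μ : Measure E)
    [μ.IsAddHaarMeasure] (e : E) (r : ℝ) :
    μ (Metric.ball e r) ≤ 2 * μ (Metric.ball e r ∩ {w | f e ≤ f w}) := by
  set A := Metric.ball e r ∩ {w | f e ≤ f w}
  have hcover : Metric.ball e r ⊆ A ∪ MeasurableEquiv.subLeft (e + e) ⁻¹' A := by
    intro w hw
    rcases le_or_gt (f e) (f w) with hle | hlt
    · exact Or.inl ⟨hw, hle⟩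
    · have hball : e + e - w ∈ Metric.ball e r := by
        rw [mem_ball_iff_norm] at hw ⊢
        rwa [add_sub_assoc, add_sub_cancel_left, norm_sub_rev]
      have hmid := hf.2 (mem_univ w) (mem_univ (e + e - w))
        (show 0 ≤ (1 / 2 : ℝ) by norm_num) (show 0 ≤ (1 / 2 : ℝ) by norm_num) (by norm_num)
      rw [← smul_add, add_sub_cancel, ← two_smul ℝ e, smul_smul, smul_eq_mul, smul_eq_mul,
        two_smul ℝ e, show (1 / 2 * 2 : ℝ) = 1 by norm_num, one_smul] at hmid
      exact Or.inr ⟨hball, show f e ≤ f (e + e - w) by linarith⟩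
  calc μ (Metric.ball e r) ≤ μ A + μ (MeasurableEquiv.subLeft (e + e) ⁻¹' A) :=
        (measure_mono hcover).trans (measure_union_le _ _)
    _ = 2 * μ A := by
        rw [(Measure.measurePreserving_sub_left μ (e + e)).measure_preimage_equiv, two_mul]

variable {Ω : Type*} [MeasurableSpace Ω] {ν : Measure Ω} [SFinite ν]

theorem measure_exists_mem_closedBall_le_of_convexOn
    {f : Ω → E → ℝ} (hf : ∀ ω, ConvexOn ℝ univ (f ω))
    (hmeas : Measurable (Function.uncurry f)) {t : ℝ} {C : ENNReal}
    (hC : ∀ w ∈ Metric.ball (0 : E) 2, ν {ω | t ≤ f ω w} ≤ C) :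
    ν {ω | ∃ e ∈ Metric.closedBall (0 : E) 1, t ≤ f ω e} ≤ 2 ^ (Module.finrank ℝ E + 1) * C := by
  set μ : Measure E := Measure.addHaar
  set V := μ (Metric.ball (0 : E) 1)
  set S : Set (Ω × E) := {z | z.2 ∈ Metric.ball (0 : E) 2 ∧ t ≤ f z.1 z.2}
  have hS : MeasurableSet S :=
    (measurable_snd measurableSet_ball).inter (measurableSet_le measurable_const hmeas)
  have hV0 : V ≠ 0 := (Metric.measure_ball_pos μ 0 one_pos).ne'
  have hVtop : V ≠ ⊤ := measure_ball_lt_top.ne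
  have hsub : {ω | ∃ e ∈ Metric.closedBall (0 : E) 1, t ≤ f ω e} ⊆
      {ω | V ≤ 2 * μ (Prod.mk ω ⁻¹' S)} := by
    rintro ω ⟨e, he, hte⟩
    have hmono : μ (Metric.ball e 1 ∩ {w | f ω e ≤ f ω w}) ≤ μ (Prod.mk ω ⁻¹' S) :=
      measure_mono fun w hw => ⟨Metric.ball_subset_ball'
        (by linarith [Metric.mem_closedBall.1 he]) hw.1, hte.trans hw.2⟩
    exact (Measure.addHaar_ball_center μ e 1).ge.trans
      ((measure_ball_le_two_mul_of_convexOn (hf ω) μ e 1).trans (by gcongr))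
  have hint : ∫⁻ ω, μ (Prod.mk ω ⁻¹' S) ∂ν ≤ C * (2 ^ Module.finrank ℝ E * V) :=
    calc ∫⁻ ω, μ (Prod.mk ω ⁻¹' S) ∂ν = ∫⁻ w, ν ((fun ω => (ω, w)) ⁻¹' S) ∂μ := by
          rw [← Measure.prod_apply hS, Measure.prod_apply_symm hS]
      _ ≤ ∫⁻ w, (Metric.ball (0 : E) 2).indicator (fun _ => C) w ∂μ := by
          refine lintegral_mono fun w => ?_
          by_cases hw : w ∈ Metric.ball (0 : E) 2
          · rw [indicator_of_mem hw]
            exact (measure_mono fun ω hω => hω.2).trans (hC w hw)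
          · refine (measure_mono_null (fun ω hω => hw hω.1) measure_empty).trans_le zero_le
      _ = C * (2 ^ Module.finrank ℝ E * V) := by
          rw [lintegral_indicator measurableSet_ball, setLIntegral_const,
            Measure.addHaar_ball_of_pos μ 0 two_pos, ENNReal.ofReal_pow zero_le_two,
            ENNReal.ofReal_ofNat]
  refine (measure_mono hsub).trans ((ENNReal.mul_le_mul_iff_right hV0 hVtop).1 ?_)
  have hF : Measurable fun ω => μ (Prod.mk ω ⁻¹' S) := measurable_measure_prodMk_left hS
  calc V * ν {ω | V ≤ 2 * μ (Prod.mk ω ⁻¹' S)}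
      ≤ ∫⁻ ω, 2 * μ (Prod.mk ω ⁻¹' S) ∂ν := mul_meas_ge_le_lintegral (hF.const_mul 2) V
    _ = 2 * ∫⁻ ω, μ (Prod.mk ω ⁻¹' S) ∂ν := lintegral_const_mul _ hF
    _ ≤ 2 * (C * (2 ^ Module.finrank ℝ E * V)) := by gcongr
    _ = V * (2 ^ (Module.finrank ℝ E + 1) * C) := by ring

variable {n p : ℕ}

theorem gaussSample_le_sum_inner_sq_le (hn : 0 < n) {v : EuclideanSpace ℝ (Fin p)}
    (hv : v ∈ Metric.ball 0 2) :
    gaussSample n p {x | 64 * (n : ℝ) ≤ ∑ i, inner ℝ (x i) v ^ 2} ≤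
      ENNReal.ofReal (2 ^ n * Real.exp (-(4 * n))) := by
  rcases eq_or_ne v 0 with rfl | hv0
  · have hn' : ¬64 * (n : ℝ) ≤ 0 := not_le.2 (by positivity)
    simp [hn']
  have h := measure_pi_le_sum_mul_sq_le (fun _ : Fin n => stdGaussian (EuclideanSpace ℝ (Fin p)))
    (fun _ => measurePreserving_inner_stdGaussian (norm_smul_inv_norm (𝕜 := ℝ) hv0))
    (a := fun _ => 1 / 4) (fun _ => by norm_num) (4 * n)
  refine (measure_mono fun x hx => ?_).trans (h.trans (ENNReal.ofReal_le_ofReal ?_))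
  · have hnorm : ‖v‖ ^ 2 ≤ 4 := by
      have := (mem_ball_zero_iff.1 hv).le
      nlinarith [norm_nonneg v]
    have hsum : ∑ i, (1 / 4 : ℝ) * inner ℝ ((‖v‖⁻¹ : ℝ) • v) (x i) ^ 2 =
        1 / 4 * ((‖v‖ ^ 2)⁻¹ * ∑ i, inner ℝ (x i) v ^ 2) := by
      simp only [real_inner_comm v, real_inner_smul_left, mul_pow, inv_pow, ← Finset.mul_sum]
    have hscale : 1 / 4 ≤ (‖v‖ ^ 2)⁻¹ := by
      rw [one_div]
      exact inv_anti₀ (by positivity) hnorm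
    have hx' : 64 * (n : ℝ) ≤ ∑ i, inner ℝ (x i) v ^ 2 := hx
    refine le_trans ?_ hsum.ge
    linarith [mul_le_mul hscale hx' (by positivity) (by positivity)]
  · rw [Finset.prod_const, Finset.card_univ, Fintype.card_fin, mul_comm]
    gcongr
    refine inv_le_of_inv_le₀ (by positivity) (Real.le_sqrt_of_sq_le ?_)
    norm_num

theorem exists_le_sum_inner_sq_of_lt_norm {x : Fin n → EuclideanSpace ℝ (Fin p)} {t : ℝ}
    (ht : 0 ≤ t) (hx : t < ‖dataMatrix x‖ ^ 2) :
    ∃ e ∈ Metric.closedBall (0 : EuclideanSpace ℝ (Fin p)) 1, t ≤ ∑ i, inner ℝ (x i) e ^ 2 := by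
  have hlt : √t < ‖dataMatrix x‖ :=
    (Real.sqrt_lt_sqrt ht hx).trans_eq (Real.sqrt_sq (norm_nonneg _))
  rw [Matrix.l2_opNorm_def] at hlt
  obtain ⟨e, he, hte⟩ := ContinuousLinearMap.exists_lt_apply_of_lt_opNorm _ hlt
  refine ⟨e, mem_closedBall_zero_iff.2 he.le, ?_⟩
  have h := (Real.sqrt_lt_sqrt_iff ht).1 (hte.trans_eq (EuclideanSpace.norm_eq _))
  refine h.le.trans_eq (Finset.sum_congr rfl fun i _ => ?_)
  simp [Matrix.mulVec, dotProduct, dataMatrix, PiLp.inner_apply, mul_comm]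

theorem gaussSample_lt_norm_dataMatrix_sq_le (hn : 0 < n) (hpn : p ≤ n) :
    gaussSample n p {x | 64 * n < ‖dataMatrix x‖ ^ 2} ≤ ENNReal.ofReal (Real.exp (-n)) := by
  have hconvex (x : Fin n → EuclideanSpace ℝ (Fin p)) :
      ConvexOn ℝ univ fun v => ∑ i, inner ℝ (x i) v ^ 2 := by
    refine ⟨convex_univ, fun v _ w _ a b ha hb hab => ?_⟩
    rw [Finset.smul_sum, Finset.smul_sum, ← Finset.sum_add_distrib]
    exact Finset.sum_le_sum fun i _ => (even_two.convexOn_pow.comp_linearMap (innerₗ _ (x i))).2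
      (mem_univ v) (mem_univ w) ha hb hab
  refine (measure_mono fun x hx => exists_le_sum_inner_sq_of_lt_norm (by positivity) hx).trans
    ((measure_exists_mem_closedBall_le_of_convexOn hconvex (Continuous.measurable (by fun_prop))
      fun v hv => gaussSample_le_sum_inner_sq_le hn hv).trans ?_)
  have htwo : (2 : ℝ) ≤ Real.exp 1 := by linarith [Real.add_one_le_exp (1 : ℝ)]
  rw [finrank_euclideanSpace, Fintype.card_fin, ← ENNReal.ofReal_ofNat,
    ← ENNReal.ofReal_pow zero_le_two, ← ENNReal.ofReal_mul (by positivity)]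
  refine ENNReal.ofReal_le_ofReal ?_
  calc (2 : ℝ) ^ (p + 1) * (2 ^ n * Real.exp (-(4 * n)))
      ≤ 2 ^ (n + n) * (2 ^ n * Real.exp (-(4 * n))) := by
        gcongr
        · exact one_le_two
        · lia
    _ ≤ Real.exp 1 ^ (n + n) * (Real.exp 1 ^ n * Real.exp (-(4 * n))) := by gcongr
    _ = Real.exp (-n) := by
        rw [← Real.exp_nat_mul, ← Real.exp_nat_mul, ← Real.exp_add, ← Real.exp_add]
        congr 1
        push_cast
        ring

end OperatorNorm

section Rate

variable {n p : ℕ} {u : ℝ → ℝ} {y : ℝ}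

theorem isBalancedDesign_of_hatRow (hn : 3 ≤ n) {x : Fin n → EuclideanSpace ℝ (Fin p)}
    (hx : Function.Injective (dataMatrix x).mulVec) {τ b η : ℝ} (hτ : 0 ≤ τ)
    (hη : ∀ i, |hatMatrix (dataMatrix x) i i - (p : ℝ) / n| ≤ η)
    (hb : ∀ i, b ≤ hatMatrix (dataMatrix x) i i * (1 - hatMatrix (dataMatrix x) i i))
    (hrow : ∀ (i : Fin n) (J : Finset {j // j ≠ i}), n ≤ 4 * J.card + 1 →
      τ * ‖hatRow i x‖ ^ 2 ≤ ∑ j ∈ J, hatRow i x j ^ 2) :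
    IsBalancedDesign (dataMatrix x) (τ * b) η where
  injective := hx
  abs_leverage_sub_le := by simpa only [Fintype.card_fin] using hη
  le_sum_sq i J hJ := by
    have hcard : J.card - 1 ≤ (J.subtype (· ≠ i)).card := by
      rw [Finset.card_subtype, Finset.filter_ne']
      exact Finset.pred_card_le_card_erase
    rw [Fintype.card_fin] at hJ
    calc τ * b ≤ τ * ‖hatRow i x‖ ^ 2 := by
          rw [norm_sq_hatRow hx]
          exact mul_le_mul_of_nonneg_left (hb i) hτ
      _ ≤ ∑ j ∈ J.subtype (· ≠ i), hatRow i x j ^ 2 := hrow i _ (by lia)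
      _ = ∑ j ∈ J with j ≠ i, hatMatrix (dataMatrix x) i j ^ 2 :=
          Finset.sum_subtype_eq_sum_filter fun j => hatMatrix (dataMatrix x) i j ^ 2
      _ ≤ ∑ j ∈ J, hatMatrix (dataMatrix x) i j ^ 2 :=
          Finset.sum_le_sum_of_subset_of_nonneg (Finset.filter_subset _ _) fun _ _ _ => sq_nonneg _

theorem gaussSample_not_isBalancedDesign_le (hn : 3 ≤ n) {r η : ℝ} (hr : 0 ≤ r) (hη : 0 < η)
    (hr1 : r + η ≤ (p : ℝ) / n) (hr2 : (p : ℝ) / n + η + r ≤ 1) :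
    gaussSample n p {x | ¬IsBalancedDesign (dataMatrix x) (1 / 2 ^ 33 * r ^ 2) η} ≤
      ENNReal.ofReal (2 * n * Real.exp (-(η ^ 2 * n / 64)) + 4 * n * (1 / 4) ^ n) := by
  have hn0 : (0 : ℝ) < n := by positivity
  have hpn : p ≤ n := Nat.cast_le.1 ((div_le_one (α := ℝ) hn0).1 (by linarith))
  have hlev : gaussSample n p {x | ∃ i, η ≤ |hatMatrix (dataMatrix x) i i - (p : ℝ) / n|} ≤
      ENNReal.ofReal (2 * n * Real.exp (-(η ^ 2 * n / 64))) := by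
    rw [ofPred_exists]
    refine (measure_iUnion_fintype_le _ _).trans ((Finset.sum_le_sum fun i _ =>
      gaussSample_abs_leverage_sub_le hpn hη (by linarith) i).trans_eq ?_)
    rw [Finset.sum_const, Finset.card_univ, Fintype.card_fin, ← ENNReal.ofReal_nsmul,
      nsmul_eq_mul, ← mul_assoc, mul_comm (n : ℝ)]
  rw [ENNReal.ofReal_add (by positivity) (by positivity)]
  refine (measure_mono_ae ?_).trans ((measure_union_le _ _).trans
    (add_le_add hlev (gaussSample_hatRow_sum_sq_lt_le (by lia))))
  filter_upwards [ae_injective_mulVec_dataMatrix hpn] with x hinj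
  refine not_imp_not.1 fun hx => ?_
  obtain ⟨hlev, hrow⟩ := not_or.1 hx
  simp only [mem_ofPred_eq, not_exists, not_and, not_le, not_lt] at hlev hrow
  refine not_not.2 (isBalancedDesign_of_hatRow hn hinj (by norm_num) (fun i => (hlev i).le)
    (fun i => ?_) hrow)
  obtain ⟨hlower, hupper⟩ := abs_lt.1 (hlev i)
  rw [sq]
  exact mul_le_mul (by linarith) (by linarith) hr (by linarith)

theorem gaussSample_not_isBalancedDesign_or_lt_norm_le (hn : 0 < n) {r η : ℝ} (hr : 0 ≤ r)
    (hη : 0 < η) (hr1 : r + η ≤ (p : ℝ) / n) (hr2 : (p : ℝ) / n + η + r ≤ 1) :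
    gaussSample n p {x | ¬IsBalancedDesign (dataMatrix x) (1 / 2 ^ 33 * r ^ 2) η ∨
        64 * n < ‖dataMatrix x‖ ^ 2} ≤
      ENNReal.ofReal (7 * n * Real.exp (-(η ^ 2 * n / 64))) := by
  have hn1 : (1 : ℝ) ≤ n := by exact_mod_cast hn
  have hη1 : η ^ 2 ≤ 1 := pow_le_one₀ hη.le (by linarith)
  have hsq : η ^ 2 * n ≤ n := mul_le_of_le_one_left (by positivity) hη1
  rcases lt_or_ge n 3 with hn3 | hn3
  · refine prob_le_one.trans (ENNReal.one_le_ofReal.2 ?_)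
    have hn2 : (n : ℝ) ≤ 2 := by exact_mod_cast Nat.le_of_lt_succ hn3
    have hexp : 1 / 2 ≤ Real.exp (-(η ^ 2 * n / 64)) := by
      linarith [Real.add_one_le_exp (-(η ^ 2 * n / 64))]
    linarith [mul_le_mul hn1 hexp (by norm_num) (by positivity)]
  have hpn : p ≤ n := Nat.cast_le.1 ((div_le_one (α := ℝ) (by positivity)).1 (by linarith))
  refine (measure_union_le _ _).trans ((add_le_add (gaussSample_not_isBalancedDesign_le hn3 hr hη
    hr1 hr2) (gaussSample_lt_norm_dataMatrix_sq_le hn hpn)).trans ?_)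
  rw [← ENNReal.ofReal_add (by positivity) (by positivity)]
  refine ENNReal.ofReal_le_ofReal ?_
  have hexp : Real.exp (-n) ≤ Real.exp (-(η ^ 2 * n / 64)) := Real.exp_le_exp.2 (by linarith)
  have hpow : (1 / 4 : ℝ) ^ n ≤ Real.exp (-n) := by
    rw [← mul_neg_one (n : ℝ), Real.exp_nat_mul, Real.exp_neg, one_div]
    gcongr
    linarith [Real.exp_one_lt_d9]
  calc 2 * n * Real.exp (-(η ^ 2 * n / 64)) + 4 * n * (1 / 4) ^ n + Real.exp (-n)
      ≤ 2 * n * Real.exp (-(η ^ 2 * n / 64)) + 4 * n * Real.exp (-(η ^ 2 * n / 64)) +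
          n * Real.exp (-(η ^ 2 * n / 64)) := by
        gcongr
        · exact hpow.trans hexp
        · exact hexp.trans (le_mul_of_one_le_left (Real.exp_pos _).le hn1)
    _ = 7 * n * Real.exp (-(η ^ 2 * n / 64)) := by ring

theorem exists_eventually_gaussSample_not_maronnaClose_le (hy0 : 0 < y) (hy1 : y < 1)
    (hA1 : AssumptionA1 u y) (hA2 : AssumptionA2 u) :
    ∃ K > 0, ∀ᶠ η in 𝓝[>] 0, ∀ᶠ q in 𝓝 y, ∀ n p : ℕ, 0 < n → (p : ℝ) / n = q →
      gaussSample n p {x | ¬MaronnaClose u y (K * η) x} ≤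
        ENNReal.ofReal (7 * n * Real.exp (-(η ^ 2 * n / 64))) := by
  obtain ⟨r, hr, hry⟩ : ∃ r > 0, r < min (y / 3) ((1 - y) / 3) :=
    exists_between (lt_min (by linarith) (by linarith))
  obtain ⟨hry0, hry1⟩ := lt_min_iff.1 hry
  obtain ⟨K, hK, hclose⟩ := exists_eventually_maronnaClose hy0 hA1 hA2
    (α := 1 / 2 ^ 33 * r ^ 2) (T := 64) (by positivity) (by norm_num)
  refine ⟨K, hK, ?_⟩
  filter_upwards [hclose, Ioo_mem_nhdsGT hr] with η hclose hη
  filter_upwards [hclose, Metric.closedBall_mem_nhds y hr] with q hclose hq n p hn hpq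
  obtain ⟨hlower, hupper⟩ := abs_le.1 (mem_closedBall_iff_norm.1 hq)
  rw [← hpq] at hlower hupper
  refine (measure_mono fun x hx => ?_).trans (gaussSample_not_isBalancedDesign_or_lt_norm_le hn
    hr.le hη.1 (by linarith [hη.2]) (by linarith [hη.2]))
  contrapose! hx
  obtain ⟨hbal, hnorm⟩ := not_or.1 hx
  exact not_not.2 (hclose n p x hn hpq (not_not.1 hbal) (not_lt.1 hnorm))

theorem exists_gaussSample_not_maronnaClose_le (hy0 : 0 < y) (hy1 : y < 1)
    (hA1 : AssumptionA1 u y) (hA2 : AssumptionA2 u) :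
    ∃ C > 0, ∃ c > 0, ∃ c' > 0, ∀ ε ∈ Ioo 0 c', ∀ᶠ q in 𝓝 y, ∀ n p : ℕ, 0 < n →
      (p : ℝ) / n = q → gaussSample n p {x | ¬MaronnaClose u y ε x} ≤
        ENNReal.ofReal (C * n * Real.exp (-c * ε ^ 2 * n)) := by
  obtain ⟨K, hK, h⟩ := exists_eventually_gaussSample_not_maronnaClose_le hy0 hy1 hA1 hA2
  obtain ⟨a, ha, h⟩ := (nhdsGT_basis 0).eventually_iff.1 h
  refine ⟨7, by norm_num, 1 / (64 * K ^ 2), by positivity, K * a, by positivity, fun ε hε => ?_⟩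
  have hη : ε / K ∈ Ioo 0 a := ⟨div_pos hε.1 hK, (div_lt_iff₀' hK).2 hε.2⟩
  filter_upwards [h hη] with q hq n p hn hpq
  convert hq n p hn hpq using 5
  · rw [mul_div_cancel₀ _ hK.ne']
  · field_simp

theorem ae_eventually_of_summable {Ω : Type*} [MeasurableSpace Ω] {μ : Measure Ω}
    {P : ℕ → Ω → Prop} {b : ℕ → ℝ} (hb : Summable b)
    (hP : ∀ᶠ n in atTop, μ {ω | ¬P n ω} ≤ ENNReal.ofReal (b n)) :
    ∀ᵐ ω ∂μ, ∀ᶠ n in atTop, P n ω := by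
  obtain ⟨N, hN⟩ := eventually_atTop.1 hP
  have h := ae_eventually_notMem (ne_top_of_le_ne_top
    ((summable_nat_add_iff N).2 hb).tsum_ofReal_ne_top
    (ENNReal.tsum_le_tsum fun n => hN (n + N) (Nat.le_add_left N n)))
  filter_upwards [h] with ω hω
  rw [← map_add_atTop_eq_nat N, eventually_map]
  exact hω.mono fun n => not_not.1

section

variable {Ω : Type*} [MeasurableSpace Ω] {μ : Measure Ω} [IsProbabilityMeasure μ]

theorem IsGaussianSample.measure_le {X : Fin n → Ω → EuclideanSpace ℝ (Fin p)}
    (hX : IsGaussianSample μ X) (s : Set (Fin n → EuclideanSpace ℝ (Fin p))) :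
    μ {ω | (fun i => X i ω) ∈ s} ≤ gaussSample n p s := by
  rw [← hX.map_eq]
  exact Measure.le_map_apply hX.aemeasurable s

theorem ae_eventually_maronnaClose {p : ℕ → ℕ}
    {X : (n : ℕ) → Fin n → Ω → EuclideanSpace ℝ (Fin (p n))}
    (hp : Tendsto (fun n : ℕ => (p n : ℝ) / n) atTop (𝓝 y)) (hX : ∀ n, IsGaussianSample μ (X n))
    {ε a C : ℝ} (ha : 0 < a)
    (h : ∀ᶠ q in 𝓝 y, ∀ n p : ℕ, 0 < n → (p : ℝ) / n = q →
      gaussSample n p {x | ¬MaronnaClose u y ε x} ≤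
        ENNReal.ofReal (C * n * Real.exp (-a * n))) :
    ∀ᵐ ω ∂μ, ∀ᶠ n in atTop, MaronnaClose u y ε fun i => X n i ω := by
  have hsum : Summable fun n : ℕ => C * n * Real.exp (-a * n) := by
    simpa only [pow_one, mul_assoc] using
      (Real.summable_pow_mul_exp_neg_nat_mul 1 ha).mul_left C
  refine ae_eventually_of_summable hsum ?_
  filter_upwards [hp.eventually h, eventually_gt_atTop 0] with n hn hn0
  exact ((hX n).measure_le {x | ¬MaronnaClose u y ε x}).trans (hn n (p n) hn0 rfl)

end

theorem tendsto_maronnaError {p : ℕ → ℕ} {x : (n : ℕ) → Fin n → EuclideanSpace ℝ (Fin (p n))}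
    {r : ℕ → ℝ} (hr : Tendsto r atTop (𝓝 0))
    (h : ∀ k, ∀ᶠ n in atTop, MaronnaClose u y (r k) (x n)) :
    Tendsto (fun n => maronnaError u y (x n)) atTop (𝓝 0) := by
  refine tendsto_order.2 ⟨fun a ha => Eventually.of_forall fun n => ha.trans_le (norm_nonneg _),
    fun a ha => ?_⟩
  obtain ⟨k, hk⟩ := (hr.eventually_lt_const ha).exists
  exact (h k).mono fun n hn => hn.2.trans_lt hk

end Rate

theorem mainTheorem5 (u : ℝ → ℝ) (y : ℝ) (hy0 : 0 < y) (hy1 : y < 1)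
    (hA1 : AssumptionA1 u y) (hA2 : AssumptionA2 u) :
    -- almost sure convergence along any array with `p / n → y`
    (∀ (Ω : Type*) [MeasurableSpace Ω] (μ : Measure Ω) [IsProbabilityMeasure μ] (p : ℕ → ℕ)
        (X : (n : ℕ) → Fin n → Ω → EuclideanSpace ℝ (Fin (p n))),
        Tendsto (fun n : ℕ => (p n : ℝ) / (n : ℝ)) atTop (𝓝 y) →
        (∀ n, IsGaussianSample μ (X n)) →
        ∀ᵐ ω ∂μ,
          (∀ᶠ n in atTop, ∃! S, IsMaronnaSolution u (fun i => X n i ω) S) ∧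
          Tendsto (fun n => maronnaError u y (fun i => X n i ω)) atTop (𝓝 0)) ∧
    -- the probability bound, on the event that the estimator exists and is unique; the bound is
    -- on the (outer) measure of the complementary event
    (∃ C c c' : ℝ, 0 < C ∧ 0 < c ∧ 0 < c' ∧ ∀ ε : ℝ, 0 < ε → ε < c' →
      ∃ δ : ℝ, 0 < δ ∧ ∀ n p : ℕ, 0 < n → |(p : ℝ) / (n : ℝ) - y| ≤ δ →
        ∀ (Ω : Type*) [MeasurableSpace Ω] (μ : Measure Ω) [IsProbabilityMeasure μ]
          (X : Fin n → Ω → EuclideanSpace ℝ (Fin p)), IsGaussianSample μ X →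
          μ {ω | (∃! S, IsMaronnaSolution u (fun i => X i ω) S) ∧
              maronnaError u y (fun i => X i ω) ≤ ε}ᶜ
            ≤ ENNReal.ofReal (C * (n : ℝ) * Real.exp (-c * ε ^ 2 * (n : ℝ)))) := by
  obtain ⟨C, hC, c, hc, c', hc', hrate⟩ :=
    exists_gaussSample_not_maronnaClose_le hy0 hy1 hA1 hA2
  refine ⟨?_, C, c, c', hC, hc, hc', fun ε hε hεc => ?_⟩
  · intro Ω _ μ _ p X hp hX
    obtain ⟨r, -, hrc, hr⟩ := exists_seq_strictAnti_tendsto' hc'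
    have hclose (k : ℕ) : ∀ᵐ ω ∂μ, ∀ᶠ n in atTop, MaronnaClose u y (r k) fun i => X n i ω :=
      ae_eventually_maronnaClose hp hX (mul_pos hc (pow_pos (hrc k).1 2))
        (by simpa only [neg_mul] using hrate (r k) (hrc k))
    filter_upwards [ae_all_iff.2 hclose] with ω hω
    exact ⟨(hω 0).mono fun n hn => hn.1, tendsto_maronnaError hr hω⟩
  · obtain ⟨δ, hδ, hδrate⟩ := Metric.nhds_basis_closedBall.eventually_iff.1 (hrate ε ⟨hε, hεc⟩)
    refine ⟨δ, hδ, fun n p hn hp Ω _ μ _ X hX => ?_⟩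
    exact (hX.measure_le {x | ¬MaronnaClose u y ε x}).trans (hδrate hp n p hn rfl)
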